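/- **Proposition 8.2.** Let $q\ge 2$ be an integer, $P=\lfloor q/2\rfloor$, and let $p$ be an integer with $1\le p\le \tfrac12 q(q-1)=\dim \mathfrak{so}(q,\mathbb R)$, where $\mathfrak{so}(q,\mathbb R)$ is the space of real skew symmetric $q\times q$ matrices. For an integer $m\ge 2$ let $O_m$ be the set of $Z\in\mathfrak{so}(q,\mathbb R)$ whose $q$ complex eigenvalues are distinct and such that the ratio of any two distinct nonzero eigenvalues is not equal to $m$ or $-m$. Let $O=\bigcap_{m\ge 2}O_m$. Let $G(p,\mathfrak{so}(q,\mathbb R))$ be the Grassmann manifold of $p$-dimensional subspaces of $\mathfrak{so}(q,\mathbb R)$ with its usual topology (the quotient topology from linearly independent $p$-tuples), and let $U$ be the set of $W\in G(p,\mathfrak{so}(q,\mathbb R))$ with $W\cap O\ne\emptyset$. The group $O(q,\mathbb R)$ acts by conjugation, $Z\mapsto gZg^{-1}$ and $W\mapsto gWg^{-1}$. For $W\in G(p,\mathfrak{so}(q,\mathbb R))$ let $\mathfrak N=\mathbb R^q\oplus W$ carry the inner product for which $\mathbb R^q\perp W$, which is the standard one on $\mathbb R^q$ and $\langle X,Y\rangle=\operatorname{trace}(XY^T)$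 on $W$, and the Lie bracket for which $W$ is central and $[v,w]\in W$ is given by $\langle [v,w],Z\rangle = Zv\cdot w$ for $v,w\in\mathbb R^q$, $Z\in W$. Let $N_W$ be the simply connected Lie group with Lie algebra $\mathfrak N$ and with the corresponding left invariant Riemannian metric, and for $Z\in W$ let $\gamma_Z(t)=\exp(tZ)$. A number $t>0$ is a conjugate value of $\gamma_Z$ if there is a Jacobi vector field along $\gamma_Z$, not identically zero, that vanishes at the parameters $0$ and $t$; a conjugate value is primitive if it is not of the form $mt_0$ with an integer $m\ge2$ and a conjugate value $t_0$. Then: 1. $O$ is an open subset of $\mathfrak{so}(q,\mathbb R)$, invariant under conjugation by elements of $O(q,\mathbb R)$, and $\mathfrak{so}(q,\mathbb R)\setminus O$ has Lebesgue measure zero. 2. $U$ is a dense open subset of $G(p,\mathfrak{so}(q,\mathbb R))$, invariant under conjugation by elements of $O(q,\mathbb R)$. 3. If $W\in U$, then $W\cap O$ is open in $W$, and $W\setminus (W\cap O)$ has Lebesgue measure zero in $W$. 4. If $W\in U$ and $Z\in W\cap O$, then $\gamma_Z$ is a geodesic of $N_W$ and has exactly $P$ distinct primitive conjugate values. -/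

import Mathlib

open scoped ContDiff Topology Manifold

noncomputable section

/-! ## Skew symmetric matrices and their inner product -/

/-- `𝔰𝔬(q, ℝ)`, the real vector space of skew symmetric `q × q` matrices. -/
def so (q : ℕ) : Submodule ℝ (Matrix (Fin q) (Fin q) ℝ) where
  carrier := {Z | Z.transpose = -Z}
  add_mem' {X Y} hX hY := by
    simp only [Set.mem_ofPred_eq] at hX hY ⊢
    rw [Matrix.transpose_add, hX, hY, neg_add]
  zero_mem' := by simp
  smul_mem' r X hX := by
    simp only [Set.mem_ofPred_eq] at hX ⊢
    rw [Matrix.transpose_smul, hX, smul_neg]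

theorem mem_so {q : ℕ} (Z : Matrix (Fin q) (Fin q) ℝ) : Z ∈ so q ↔ Z.transpose = -Z := Iff.rfl

section FrobeniusNorm

attribute [local instance] Matrix.frobeniusNormedAddCommGroup Matrix.frobeniusNormedSpace

/-- The inner product `⟨X, Y⟩ = trace (X Yᵀ)` on real square matrices. -/
@[reducible]
def matrixInnerProductSpace (q : ℕ) :
    InnerProductSpace ℝ (Matrix (Fin q) (Fin q) ℝ) where
  inner X Y := (X * Y.transpose).trace
  norm_sq_eq_re_inner X := by
    rw [Matrix.frobenius_norm_def, ← Real.sqrt_eq_rpow, Real.sq_sqrt (by positivity)]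
    simp [Matrix.trace, Matrix.mul_apply, pow_two]
  conj_inner_symm X Y := by
    simp only [conj_trivial]
    rw [← Matrix.trace_transpose, Matrix.transpose_mul, Matrix.transpose_transpose]
  add_left X Y Z := by simp [add_mul]
  smul_left X Y r := by simp

attribute [local instance] matrixInnerProductSpace

instance (q : ℕ) : NormedAddCommGroup (so q) := (so q).normedAddCommGroup

instance (q : ℕ) : TopologicalSpace (so q) :=
  (inferInstance : NormedAddCommGroup (so q)).toPseudoMetricSpace.toUniformSpace.toTopologicalSpace

/-- The inner product `⟨X, Y⟩ = trace (X Yᵀ)` on `𝔰𝔬(q, ℝ)`. -/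
instance (q : ℕ) : InnerProductSpace ℝ (so q) := (so q).innerProductSpace

end FrobeniusNorm

theorem inner_so {q : ℕ} (X Y : so q) : inner ℝ X Y =
    ((X : Matrix (Fin q) (Fin q) ℝ) * (Y : Matrix (Fin q) (Fin q) ℝ).transpose).trace := rfl

/-- The topology of `𝔰𝔬(q, ℝ)` is the subspace topology of the space of matrices. -/
theorem isInducing_so (q : ℕ) :
    Topology.IsInducing (fun Z : so q => (Z : Matrix (Fin q) (Fin q) ℝ)) := ⟨rfl⟩

/-- The action of `g ∈ O(q, ℝ)` on `𝔰𝔬(q, ℝ)` by conjugation, `Z ↦ g Z g⁻¹`. -/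
def soConj {q : ℕ} (g : Matrix.orthogonalGroup (Fin q) ℝ) : so q ≃ₗ[ℝ] so q where
  toFun Z := ⟨(g : Matrix (Fin q) (Fin q) ℝ) * Z * (g⁻¹ : Matrix.orthogonalGroup (Fin q) ℝ), by
    have hZ := (mem_so _).1 Z.2
    rw [mem_so, Matrix.UnitaryGroup.inv_val, Matrix.star_eq_conjTranspose,
      Matrix.conjTranspose_eq_transpose_of_trivial]
    simp only [Matrix.transpose_mul, Matrix.transpose_transpose, hZ]
    simp [mul_assoc]⟩
  map_add' X Y := by ext1; simp [mul_add, add_mul]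
  map_smul' r X := by ext1; simp
  invFun Z := ⟨((g⁻¹ : Matrix.orthogonalGroup (Fin q) ℝ) : Matrix (Fin q) (Fin q) ℝ) * Z * g, by
    have hZ := (mem_so _).1 Z.2
    rw [mem_so, Matrix.UnitaryGroup.inv_val, Matrix.star_eq_conjTranspose,
      Matrix.conjTranspose_eq_transpose_of_trivial]
    simp only [Matrix.transpose_mul, Matrix.transpose_transpose, hZ]
    simp [mul_assoc]⟩
  left_inv X := by
    have h : ((g⁻¹ : Matrix.orthogonalGroup (Fin q) ℝ) : Matrix (Fin q) (Fin q) ℝ) * g = 1 :=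
      congrArg Subtype.val (inv_mul_cancel g)
    ext1
    calc _ = (((g⁻¹ : Matrix.orthogonalGroup (Fin q) ℝ) : Matrix (Fin q) (Fin q) ℝ) * g) * X *
          (((g⁻¹ : Matrix.orthogonalGroup (Fin q) ℝ) : Matrix (Fin q) (Fin q) ℝ) * g) := by
            simp only [mul_assoc]
      _ = _ := by rw [h, one_mul, mul_one]
  right_inv X := by
    have h : (g : Matrix (Fin q) (Fin q) ℝ) * (g⁻¹ : Matrix.orthogonalGroup (Fin q) ℝ) = 1 :=
      congrArg Subtype.val (mul_inv_cancel g)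
    ext1
    calc _ = ((g : Matrix (Fin q) (Fin q) ℝ) * (g⁻¹ : Matrix.orthogonalGroup (Fin q) ℝ)) * X *
          ((g : Matrix (Fin q) (Fin q) ℝ) * (g⁻¹ : Matrix.orthogonalGroup (Fin q) ℝ)) := by
            simp only [mul_assoc]
      _ = _ := by rw [h, one_mul, mul_one]

/-- The (complex) eigenvalues of a real matrix, listed with algebraic multiplicity. -/
def complexEigenvalues {q : ℕ} (Z : Matrix (Fin q) (Fin q) ℝ) : Multiset ℂ :=
  (Z.map (algebraMap ℝ ℂ)).charpoly.roots

/-- `O_m`: the `q` eigenvalues are distinct, and the ratio of two distinct nonzero eigenvalues is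
never `m` or `-m`. -/
def soRatio (q m : ℕ) : Set (so q) :=
  {Z | (complexEigenvalues (Z : Matrix (Fin q) (Fin q) ℝ)).Nodup ∧
    ∀ μ ∈ complexEigenvalues (Z : Matrix (Fin q) (Fin q) ℝ),
    ∀ ν ∈ complexEigenvalues (Z : Matrix (Fin q) (Fin q) ℝ),
      μ ≠ ν → μ ≠ 0 → ν ≠ 0 → μ / ν ≠ (m : ℂ) ∧ μ / ν ≠ -(m : ℂ)}

/-- `O = ⋂_{m ≥ 2} O_m`. -/
def soGeneric (q : ℕ) : Set (so q) := ⋂ m : ℕ, ⋂ _ : 2 ≤ m, soRatio q m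

/-! ## Lebesgue null sets in a finite dimensional vector space -/

/-- A subset of a finite dimensional real vector space has Lebesgue measure zero: its image in
`ℝⁿ` under linear coordinates is null (in one, equivalently in every, system of coordinates). -/
def IsLebesgueNull {V : Type*} [AddCommGroup V] [Module ℝ V] (A : Set V) : Prop :=
  ∀ b : Module.Basis (Fin (Module.finrank ℝ V)) ℝ V,
    MeasureTheory.volume (b.equivFun '' A) = 0

/-! ## Grassmann manifolds -/

/-- The Grassmannian of `p`-dimensional subspaces of a real vector space. -/
def Grassmann (p : ℕ) (V : Type*) [AddCommGroup V] [Module ℝ V] : Type _ :=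
  {W : Submodule ℝ V // Module.finrank ℝ W = p}

namespace Grassmann

/-- The map sending a linearly independent `p`-tuple to its span. -/
def ofFrame (p : ℕ) (V : Type*) [AddCommGroup V] [Module ℝ V]
    (v : {v : Fin p → V // LinearIndependent ℝ v}) : Grassmann p V :=
  ⟨Submodule.span ℝ (Set.range v.1), by simpa using finrank_span_eq_card v.2⟩

/-- The quotient topology for `ofFrame`. -/
instance (p : ℕ) (V : Type*) [AddCommGroup V] [Module ℝ V] [TopologicalSpace V] :
    TopologicalSpace (Grassmann p V) :=
  TopologicalSpace.coinduced (ofFrame p V) inferInstance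

/-- The action of a linear automorphism on the Grassmannian. -/
def map {p : ℕ} {V : Type*} [AddCommGroup V] [Module ℝ V] (e : V ≃ₗ[ℝ] V) (W : Grassmann p V) :
    Grassmann p V :=
  ⟨W.1.map (e : V →ₗ[ℝ] V), (LinearEquiv.finrank_map_eq e W.1).trans W.2⟩

end Grassmann

/-- `U`: the `p`-planes in `𝔰𝔬(q, ℝ)` that meet `O`. -/
def grassmannGeneric (p q : ℕ) : Set (Grassmann p (so q)) :=
  {W | ((W.1 : Set (so q)) ∩ soGeneric q).Nonempty}

/-! ## The metric 2-step nilpotent Lie algebra `ℝ^q ⊕ W` -/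

/-- The bracket `[v, w] ∈ W` of `v, w ∈ ℝ^q`: the element of `W` with
`⟨[v, w], Z⟩ = Z v · w` for all `Z ∈ W` (see `inner_bracketV`). -/
def bracketV {q : ℕ} (W : Submodule ℝ (so q)) (v w : EuclideanSpace ℝ (Fin q)) : W :=
  (InnerProductSpace.toDual ℝ W).symm
    (LinearMap.toContinuousLinearMap
      { toFun := fun Z : W =>
          inner ℝ (Matrix.toEuclideanLin (Z : Matrix (Fin q) (Fin q) ℝ) v) w
        map_add' := fun X Y => by simp [inner_add_left]
        map_smul' := fun r X => by simp [inner_smul_left] })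

theorem inner_bracketV {q : ℕ} (W : Submodule ℝ (so q)) (v w : EuclideanSpace ℝ (Fin q))
    (Z : W) : inner ℝ (bracketV W v w) Z =
      inner ℝ (Matrix.toEuclideanLin (Z : Matrix (Fin q) (Fin q) ℝ) v) w := by
  simp [bracketV]

theorem bracketV_self {q : ℕ} (W : Submodule ℝ (so q)) (v : EuclideanSpace ℝ (Fin q)) :
    bracketV W v v = 0 := by
  refine ext_inner_right ℝ fun Z => ?_
  rw [inner_bracketV]
  refine Eq.trans ?_ (inner_zero_left (𝕜 := ℝ) Z).symm
  have hZ := (mem_so _).1 (Z : so q).2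
  have h : inner ℝ (Matrix.toEuclideanLin ((Z : so q) : Matrix (Fin q) (Fin q) ℝ) v) v =
      -inner ℝ (Matrix.toEuclideanLin ((Z : so q) : Matrix (Fin q) (Fin q) ℝ) v) v := by
    conv_lhs => rw [real_inner_comm, ← LinearMap.adjoint_inner_left,
      ← Matrix.toEuclideanLin_conjTranspose_eq_adjoint,
      Matrix.conjTranspose_eq_transpose_of_trivial, hZ]
    simp
  linarith

/-- `bracketV` as a bilinear map. -/
def bracketL {q : ℕ} (W : Submodule ℝ (so q)) :
    EuclideanSpace ℝ (Fin q) →ₗ[ℝ] EuclideanSpace ℝ (Fin q) →ₗ[ℝ] W :=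
  LinearMap.mk₂ ℝ (bracketV W)
    (fun a b c => ext_inner_right (E := W) ℝ fun Z => by
      rw [inner_add_left (E := W)]
      simp only [inner_bracketV, map_add, inner_add_left])
    (fun r a b => ext_inner_right (E := W) ℝ fun Z => by
      rw [real_inner_smul_left (F := W)]
      simp only [inner_bracketV, map_smul, real_inner_smul_left])
    (fun a b c => ext_inner_right (E := W) ℝ fun Z => by
      rw [inner_add_left (E := W)]
      simp only [inner_bracketV, inner_add_right])
    (fun r a b => ext_inner_right (E := W) ℝ fun Z => by
      rw [real_inner_smul_left (F := W)]
      simp only [inner_bracketV, real_inner_smul_right])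

/-- `𝔑 = ℝ^q ⊕ W`. -/
def NilAlgebra {q : ℕ} (W : Submodule ℝ (so q)) : Type :=
  EuclideanSpace ℝ (Fin q) × W

namespace NilAlgebra

instance {q : ℕ} (W : Submodule ℝ (so q)) : NormedAddCommGroup (NilAlgebra W) :=
  inferInstanceAs (NormedAddCommGroup (EuclideanSpace ℝ (Fin q) × W))

instance {q : ℕ} (W : Submodule ℝ (so q)) : NormedSpace ℝ (NilAlgebra W) :=
  inferInstanceAs (NormedSpace ℝ (EuclideanSpace ℝ (Fin q) × W))

instance {q : ℕ} (W : Submodule ℝ (so q)) : FiniteDimensional ℝ (NilAlgebra W) :=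
  inferInstanceAs (FiniteDimensional ℝ (EuclideanSpace ℝ (Fin q) × W))

/-- The projection `𝔑 → ℝ^q`. -/
def projV {q : ℕ} (W : Submodule ℝ (so q)) : NilAlgebra W →L[ℝ] EuclideanSpace ℝ (Fin q) :=
  ContinuousLinearMap.fst ℝ (EuclideanSpace ℝ (Fin q)) W

/-- The projection `𝔑 → W`. -/
def projW {q : ℕ} (W : Submodule ℝ (so q)) : NilAlgebra W →L[ℝ] W :=
  ContinuousLinearMap.snd ℝ (EuclideanSpace ℝ (Fin q)) W

/-- The inclusion `W → 𝔑` of the central summand. -/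
def inclW {q : ℕ} (W : Submodule ℝ (so q)) : W →L[ℝ] NilAlgebra W :=
  ContinuousLinearMap.inr ℝ (EuclideanSpace ℝ (Fin q)) W

theorem ext_proj {q : ℕ} {W : Submodule ℝ (so q)} {x y : NilAlgebra W}
    (h1 : projV W x = projV W y) (h2 : projW W x = projW W y) : x = y := Prod.ext h1 h2

@[simp] theorem projV_inclW {q : ℕ} (W : Submodule ℝ (so q)) (z : W) :
    projV W (inclW W z) = 0 := rfl

@[simp] theorem projW_inclW {q : ℕ} (W : Submodule ℝ (so q)) (z : W) :
    projW W (inclW W z) = z := rfl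

/-- The Lie bracket: `[v + Z, v' + Z'] = [v, v']`, so that `W` is central. -/
instance {q : ℕ} (W : Submodule ℝ (so q)) : Bracket (NilAlgebra W) (NilAlgebra W) where
  bracket x y := inclW W (bracketL W (projV W x) (projV W y))

theorem bracket_def {q : ℕ} {W : Submodule ℝ (so q)} (x y : NilAlgebra W) :
    ⁅x, y⁆ = inclW W (bracketL W (projV W x) (projV W y)) := rfl

instance {q : ℕ} (W : Submodule ℝ (so q)) : LieRing (NilAlgebra W) where
  add_lie x y z := by simp [bracket_def]
  lie_add x y z := by simp [bracket_def]
  lie_self x := by simp [bracket_def, bracketL, bracketV_self]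
  leibniz_lie x y z := by simp [bracket_def]

instance {q : ℕ} (W : Submodule ℝ (so q)) : LieAlgebra ℝ (NilAlgebra W) where
  lie_smul r x y := by simp [bracket_def]

/-- The inner product on `𝔑` for which `ℝ^q ⊥ W`, which is the standard inner product on `ℝ^q`
and `trace (X Yᵀ)` on `W`. -/
def innerForm {q : ℕ} (W : Submodule ℝ (so q)) :
    NilAlgebra W →L[ℝ] NilAlgebra W →L[ℝ] ℝ :=
  (innerSL ℝ (E := EuclideanSpace ℝ (Fin q))).bilinearComp (projV W) (projV W) +
    (innerSL ℝ (E := W)).bilinearComp (projW W) (projW W)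

theorem innerForm_apply {q : ℕ} (W : Submodule ℝ (so q)) (x y : NilAlgebra W) :
    innerForm W x y =
      inner ℝ (projV W x) (projV W y) + inner ℝ (projW W x) (projW W y) := rfl

end NilAlgebra

/-! ## The simply connected Lie group `N_W` -/

/-- The simply connected nilpotent Lie group with Lie algebra `NilAlgebra W`: the underlying
manifold is the vector space `NilAlgebra W`, and the product is given by the
Baker-Campbell-Hausdorff formula `x * y = x + y + (1/2) [x, y]`. -/
def NilGroup {q : ℕ} (W : Submodule ℝ (so q)) : Type := NilAlgebra W

namespace NilGroup

instance {q : ℕ} (W : Submodule ℝ (so q)) : NormedAddCommGroup (NilGroup W) :=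
  inferInstanceAs (NormedAddCommGroup (NilAlgebra W))

instance {q : ℕ} (W : Submodule ℝ (so q)) : NormedSpace ℝ (NilGroup W) :=
  inferInstanceAs (NormedSpace ℝ (NilAlgebra W))

instance {q : ℕ} (W : Submodule ℝ (so q)) : FiniteDimensional ℝ (NilGroup W) :=
  inferInstanceAs (FiniteDimensional ℝ (NilAlgebra W))

/-- The Lie group exponential map `𝔑 → N_W`; in this model of `N_W` it is the identity. -/
def exp {q : ℕ} (W : Submodule ℝ (so q)) : NilAlgebra W ≃L[ℝ] NilGroup W :=
  ContinuousLinearEquiv.refl ℝ (NilAlgebra W)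

/-- The inverse of `exp`. -/
def log {q : ℕ} (W : Submodule ℝ (so q)) : NilGroup W ≃L[ℝ] NilAlgebra W := (exp W).symm

@[simp] theorem log_exp {q : ℕ} (W : Submodule ℝ (so q)) (x : NilAlgebra W) :
    log W (exp W x) = x := rfl

instance {q : ℕ} (W : Submodule ℝ (so q)) : Mul (NilGroup W) where
  mul x y := exp W (log W x + log W y + (1 / 2 : ℝ) • ⁅log W x, log W y⁆)

instance {q : ℕ} (W : Submodule ℝ (so q)) : One (NilGroup W) where
  one := exp W 0

instance {q : ℕ} (W : Submodule ℝ (so q)) : Inv (NilGroup W) where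
  inv x := exp W (-log W x)

theorem mul_def {q : ℕ} {W : Submodule ℝ (so q)} (x y : NilGroup W) :
    x * y = exp W (log W x + log W y + (1 / 2 : ℝ) • ⁅log W x, log W y⁆) := rfl

theorem one_def {q : ℕ} {W : Submodule ℝ (so q)} : (1 : NilGroup W) = exp W 0 := rfl

theorem inv_def {q : ℕ} {W : Submodule ℝ (so q)} (x : NilGroup W) :
    x⁻¹ = exp W (-log W x) := rfl

instance {q : ℕ} (W : Submodule ℝ (so q)) : Group (NilGroup W) where
  mul_assoc x y z := by
    simp only [mul_def, log_exp]
    congr 1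
    simp only [NilAlgebra.bracket_def]
    simp only [map_add, map_smul, NilAlgebra.projV_inclW, LinearMap.add_apply,
      smul_zero, add_zero, smul_add]
    abel
  one_mul x := by simp [mul_def, one_def, log]
  mul_one x := by simp [mul_def, one_def, log]
  inv_mul_cancel x := by simp [mul_def, one_def, inv_def]

theorem contDiff_mul {q : ℕ} (W : Submodule ℝ (so q)) :
    ContDiff ℝ ∞ (fun x : NilGroup W × NilGroup W => x.1 * x.2) := by
  let b : EuclideanSpace ℝ (Fin q) →L[ℝ] EuclideanSpace ℝ (Fin q) →L[ℝ] W :=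
    LinearMap.toContinuousBilinearMap (bracketL W)
  have hb : ∀ x y : NilAlgebra W,
      ⁅x, y⁆ = NilAlgebra.inclW W (b (NilAlgebra.projV W x) (NilAlgebra.projV W y)) :=
    fun x y => rfl
  simp only [mul_def, hb]
  fun_prop

instance {q : ℕ} (W : Submodule ℝ (so q)) :
    LieGroup (modelWithCornersSelf ℝ (NilGroup W)) ∞ (NilGroup W) where
  contMDiff_mul := by
    have := (contDiff_mul W).contMDiff
    rwa [modelWithCornersSelf_prod, ← chartedSpaceSelf_prod] at this
  contMDiff_inv := by
    have : ContDiff ℝ ∞ (fun x : NilGroup W => x⁻¹) := by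
      simp only [inv_def]; fun_prop
    exact this.contMDiff

/-- `t ↦ exp (t X)` is a one-parameter subgroup. -/
theorem exp_add_smul {q : ℕ} (W : Submodule ℝ (so q)) (X : NilAlgebra W) (s t : ℝ) :
    exp W ((s + t) • X) = exp W (s • X) * exp W (t • X) := by
  simp [mul_def, add_smul]

/-- The left invariant vector field with value `X` at the identity. -/
def leftInvariantField {q : ℕ} (W : Submodule ℝ (so q)) (X : NilAlgebra W) (x : NilGroup W) :
    NilGroup W :=
  fderiv ℝ (fun y : NilGroup W => x * y) 1 (exp W X)

/-- The Lie bracket as a bilinear map on the underlying vector space of `N_W`. -/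
def bracketN {q : ℕ} (W : Submodule ℝ (so q)) :
    NilGroup W →ₗ[ℝ] NilGroup W →ₗ[ℝ] NilGroup W :=
  LinearMap.mk₂ ℝ (fun x y => exp W ⁅log W x, log W y⁆) (by simp) (by simp) (by simp) (by simp)

theorem fderiv_mul_left {q : ℕ} (W : Submodule ℝ (so q)) (x y v : NilGroup W) :
    fderiv ℝ (fun y : NilGroup W => x * y) y v = v + (1 / 2 : ℝ) • bracketN W x v := by
  have h : (fun y : NilGroup W => x * y) =
      fun y => x + (ContinuousLinearMap.id ℝ (NilGroup W) +
        (1 / 2 : ℝ) • LinearMap.toContinuousLinearMap (bracketN W x) :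
          NilGroup W →L[ℝ] NilGroup W) y := by
    funext y
    simp [mul_def, bracketN, log, add_assoc]
  rw [h, fderiv_const_add, ContinuousLinearMap.fderiv]
  simp

/-- The Lie algebra of left invariant vector fields on `N_W` is `𝔑 = ℝ^q ⊕ W`. -/
theorem lieBracket_leftInvariantField {q : ℕ} (W : Submodule ℝ (so q)) (X Y : NilAlgebra W) :
    VectorField.lieBracket ℝ (leftInvariantField W X) (leftInvariantField W Y) =
      leftInvariantField W ⁅X, Y⁆ := by
  have key : ∀ X : NilAlgebra W, leftInvariantField W X = fun x =>
      exp W X + ((1 / 2 : ℝ) •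
        LinearMap.toContinuousLinearMap ((bracketN W).flip (exp W X))) x := by
    intro X; funext x; simp [leftInvariantField, fderiv_mul_left]
  have hXY : ⁅X, Y⁆ = (1 / 2 : ℝ) • ⁅X, Y⁆ - (1 / 2 : ℝ) • ⁅Y, X⁆ := by
    rw [← lie_skew Y X]; module
  funext x
  rw [VectorField.lieBracket, key, key, key, fderiv_const_add, fderiv_const_add,
    ContinuousLinearMap.fderiv, ContinuousLinearMap.fderiv]
  trans exp W ((1 / 2 : ℝ) • ⁅X, Y⁆ - (1 / 2 : ℝ) • ⁅Y, X⁆)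
  · simp [bracketN, NilAlgebra.bracket_def]
  · rw [← hXY]
    simp [bracketN, NilAlgebra.bracket_def]

/-- The left invariant Riemannian metric: `⟨u, v⟩_x` is the inner product on `𝔑 = T_1 N_W` of the
images of `u` and `v` under the differential at `x` of left translation by `x⁻¹`. -/
def metric {q : ℕ} (W : Submodule ℝ (so q)) (x : NilGroup W) :
    NilGroup W →L[ℝ] NilGroup W →L[ℝ] ℝ :=
  (NilAlgebra.innerForm W).bilinearComp
    ((log W : NilGroup W →L[ℝ] NilAlgebra W).comp (fderiv ℝ (fun y : NilGroup W => x⁻¹ * y) x))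
    ((log W : NilGroup W →L[ℝ] NilAlgebra W).comp (fderiv ℝ (fun y : NilGroup W => x⁻¹ * y) x))

/-- The curve `γ_Z(t) = exp (t Z)` in `N_W`, for `Z ∈ W`. -/
def centralGeodesic {q : ℕ} (W : Submodule ℝ (so q)) (Z : W) (t : ℝ) : NilGroup W :=
  exp W (t • NilAlgebra.inclW W Z)

end NilGroup

/-! ## Riemannian geometry in a global chart

`g : E → E →L[ℝ] E →L[ℝ] ℝ` is a smooth Riemannian metric on the vector space `E`, and tangent
spaces of `E` are identified with `E`. -/

namespace RiemChart

/-- The Christoffel symbols `Γ_x(u, v)` of the Levi-Civita connection, that is,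
`g (Γ(u, v), w) = 1/2 (∂_u g(v, w) + ∂_v g(u, w) - ∂_w g(u, v))` for all `w`. -/
def christoffel {E : Type*} [NormedAddCommGroup E] [NormedSpace ℝ E]
    (g : E → E →L[ℝ] E →L[ℝ] ℝ) (x u v : E) : E :=
  (g x).inverse ((1 / 2 : ℝ) •
    (fderiv ℝ g x u v + fderiv ℝ g x v u - ((fderiv ℝ g x).flip u).flip v))

/-- The curvature tensor `R(u, v) w = ∇_u ∇_v w - ∇_v ∇_u w - ∇_[u,v] w`, computed on constant
vector fields `u, v, w`. -/
def curvature {E : Type*} [NormedAddCommGroup E] [NormedSpace ℝ E]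
    (g : E → E →L[ℝ] E →L[ℝ] ℝ) (x u v w : E) : E :=
  fderiv ℝ (fun y => christoffel g y v w) x u - fderiv ℝ (fun y => christoffel g y u w) x v
    + christoffel g x u (christoffel g x v w) - christoffel g x v (christoffel g x u w)

/-- The covariant derivative of a vector field `Y` along the curve `γ`. -/
def covDeriv {E : Type*} [NormedAddCommGroup E] [NormedSpace ℝ E]
    (g : E → E →L[ℝ] E →L[ℝ] ℝ) (γ Y : ℝ → E) (t : ℝ) : E :=
  deriv Y t + christoffel g (γ t) (deriv γ t) (Y t)

/-- `γ` is a geodesic, defined for all times. -/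
def IsGeodesic {E : Type*} [NormedAddCommGroup E] [NormedSpace ℝ E]
    (g : E → E →L[ℝ] E →L[ℝ] ℝ) (γ : ℝ → E) : Prop :=
  ContDiff ℝ ∞ γ ∧ ∀ t, covDeriv g γ (deriv γ) t = 0

/-- `Y` is a Jacobi vector field along `γ`: `Y'' + R(Y, γ') γ' = 0`. -/
def IsJacobiField {E : Type*} [NormedAddCommGroup E] [NormedSpace ℝ E]
    (g : E → E →L[ℝ] E →L[ℝ] ℝ) (γ Y : ℝ → E) : Prop :=
  ContDiff ℝ ∞ Y ∧
    ∀ t, covDeriv g γ (covDeriv g γ Y) t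
      + curvature g (γ t) (Y t) (deriv γ t) (deriv γ t) = 0

/-- `t > 0` is a conjugate value of `γ`: `γ t` is conjugate to `γ 0` along `γ`. -/
def IsConjugateValue {E : Type*} [NormedAddCommGroup E] [NormedSpace ℝ E]
    (g : E → E →L[ℝ] E →L[ℝ] ℝ) (γ : ℝ → E) (t : ℝ) : Prop :=
  0 < t ∧ ∃ Y : ℝ → E, IsJacobiField g γ Y ∧ Y ≠ 0 ∧ Y 0 = 0 ∧ Y t = 0

/-- A conjugate value is primitive if it is not `m t₀` with an integer `m ≥ 2` and a conjugate
value `t₀`. -/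
def IsPrimitiveConjugateValue {E : Type*} [NormedAddCommGroup E] [NormedSpace ℝ E]
    (g : E → E →L[ℝ] E →L[ℝ] ℝ) (γ : ℝ → E) (t : ℝ) : Prop :=
  IsConjugateValue g γ t ∧
    ∀ (m : ℕ) (t₀ : ℝ), 2 ≤ m → IsConjugateValue g γ t₀ → t ≠ m * t₀

end RiemChart

end

/-! The eigenvalues of a skew symmetric `Z` are `-iλ` with `λ` real ("frequencies"), and they are
symmetric under negation. Membership in `O` is therefore the nonvanishing of `ratioDet s Z` for `s =
1/m`, `m ≥ 2` (`mem_soGeneric_iff`), where `ratioDet` is a polynomial in `s` and the entries of `Z`.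
Its limit value `s = 0` only asks for distinct eigenvalues, so adding it changes nothing and makes
the parameter set compact. Projection along a compact factor is a closed map, hence `O` is open
(`isOpen_soGeneric`).

On a line through a point of `O` each of these countably many polynomials is nonzero, so the line
leaves `O` only at countably many parameters (`countable_line_notMem_soGeneric`). This gives density
at once, and measure zero by Fubini and scaling, in any space mapping linearly to `so q` and hitting
`O`. An explicit antidiagonal matrix shows that `O` is nonempty. The statements on the Grassmannian
follow by working with frames.

For the geometry, the metric does not change under central translations, so all data along `γ_Z` can
be computed at the identity, and in the chart the Jacobi equation becomes `Y'' = Z Y'`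
(`isJacobiField_iff`). The central part of `Y` is affine in `t`. Along an eigenvector with
eigenvalue `μ ≠ 0`, a solution vanishing at `0` is a multiple of `e^{μt} - 1`. Hence the conjugate
values are exactly `2πn/λ` with `λ` a positive frequency and `n ≥ 1`. If `2π/λ` were `m ≥ 2` times
another conjugate value, one frequency would be an integer multiple `≥ 2` of another, which `O`
forbids. So the primitive values are the `2π/λ`, and the symmetry of the simple spectrum gives
`⌊q/2⌋` positive frequencies. -/

noncomputable section


/-! ### A polynomial that detects eigenvalue coincidences -/

section RatioDet
open Polynomial

/-- The characteristic polynomial, divided by `X` when the size of the matrix is odd. -/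
def reducedCharpoly {R : Type*} [CommRing R] {q : ℕ} (M : Matrix (Fin q) (Fin q) R) : R[X] :=
  if Even q then M.charpoly else M.charpoly.divX

/-- A polynomial in `s` and the entries of `M`. For a skew symmetric matrix and `s = 1 / m` it
vanishes precisely when there is a multiple eigenvalue or a pair of eigenvalues of ratio `m`. -/
def ratioDet {R : Type*} [CommRing R] {q : ℕ} (s : R) (M : Matrix (Fin q) (Fin q) R) : R :=
  (aeval (s • M) (reducedCharpoly M)).det * (aeval M (derivative M.charpoly)).det

theorem map_divX_ringHom {R S : Type*} [CommRing R] [CommRing S] (f : R →+* S) (p : R[X]) :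
    p.divX.map f = (p.map f).divX := by
  ext n; simp

theorem reducedCharpoly_map {R S : Type*} [CommRing R] [CommRing S] (f : R →+* S) {q : ℕ}
    (M : Matrix (Fin q) (Fin q) R) :
    reducedCharpoly (M.map f) = (reducedCharpoly M).map f := by
  unfold reducedCharpoly
  split_ifs <;> simp [Matrix.charpoly_map, map_divX_ringHom]

theorem aeval_matrix_map {R S : Type*} [CommRing R] [CommRing S] (f : R →+* S) {q : ℕ}
    (M : Matrix (Fin q) (Fin q) R) (p : R[X]) :
    aeval (M.map f) (p.map f) = (aeval M p).map f := by
  have := Polynomial.map_aeval_eq_aeval_map (φ := f) (ψ := f.mapMatrix)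
    (by ext r i j; simp [Matrix.algebraMap_matrix_apply]; split_ifs <;> simp) p M
  simpa using this.symm

/-- Every ingredient commutes with ring homomorphisms, since the parity split depends only on the
size of the matrix. Evaluating `ratioDet` on a matrix with polynomial entries and then specialising
shows that it is polynomial in its arguments; continuity and the behaviour on lines are read off
this way. -/
theorem ratioDet_map {R S : Type*} [CommRing R] [CommRing S] (f : R →+* S) {q : ℕ} (s : R)
    (M : Matrix (Fin q) (Fin q) R) : ratioDet (f s) (M.map f) = f (ratioDet s M) := by
  have h : f s • M.map f = (s • M).map f := by ext i j; simp
  rw [ratioDet, ratioDet, h, reducedCharpoly_map, Matrix.charpoly_map, derivative_map,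
    aeval_matrix_map, aeval_matrix_map, map_mul, RingHom.map_det, RingHom.map_det]
  rfl

theorem continuous_ratioDet (q : ℕ) :
    Continuous fun x : ℝ × Matrix (Fin q) (Fin q) ℝ => ratioDet x.1 x.2 := by
  let P : MvPolynomial (Option (Fin q × Fin q)) ℝ :=
    ratioDet (MvPolynomial.X none) (Matrix.of fun i j => MvPolynomial.X (some (i, j)))
  let c : ℝ × Matrix (Fin q) (Fin q) ℝ → Option (Fin q × Fin q) → ℝ :=
    fun x o => o.elim x.1 fun ij => x.2 ij.1 ij.2
  have h : (fun x : ℝ × Matrix (Fin q) (Fin q) ℝ => ratioDet x.1 x.2) =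
      fun x => MvPolynomial.eval (c x) P := by
    funext x
    simp only [P]
    rw [← ratioDet_map]
    congr 1
    · simp [c]
    · ext i j; simp [c]
  rw [h]
  refine (MvPolynomial.continuous_eval P).comp (continuous_pi fun o => ?_)
  cases o with
  | none => exact continuous_fst
  | some ij => exact (continuous_snd.matrix_elem ij.1 ij.2)

theorem exists_ratioDet_line {q : ℕ} (s : ℝ) (M N : Matrix (Fin q) (Fin q) ℝ) :
    ∃ p : ℝ[X], ∀ t : ℝ, ratioDet s (M + t • N) = p.eval t := by
  refine ⟨ratioDet (C s) (M.map C + (X : ℝ[X]) • N.map C), fun t => ?_⟩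
  rw [← coe_evalRingHom, ← ratioDet_map]
  congr 1
  · simp
  · ext i j; simp; ring

/-- Spectral mapping: the eigenvalues of `p(M)` are the values of `p` at the eigenvalues of `M`. -/
theorem det_aeval_ne_zero_iff {q : ℕ} [NeZero q] (M : Matrix (Fin q) (Fin q) ℂ) (p : ℂ[X]) :
    (aeval M p).det ≠ 0 ↔ ∀ μ ∈ M.charpoly.roots, p.eval μ ≠ 0 := by
  have h1 : (aeval M p).det ≠ 0 ↔ (0 : ℂ) ∉ spectrum ℂ (aeval M p) := by
    rw [spectrum.zero_mem_iff, not_not, Matrix.isUnit_iff_isUnit_det, isUnit_iff_ne_zero]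
  rw [h1, spectrum.map_polynomial_aeval_of_nonempty _ _
    (spectrum.nonempty_of_isAlgClosed_of_finiteDimensional ℂ M)]
  simp only [Set.mem_image, not_exists, not_and, Matrix.mem_spectrum_iff_isRoot_charpoly,
    mem_roots (M.charpoly_monic.ne_zero)]

theorem nodup_roots_iff_derivative {p : ℂ[X]} (hp : p ≠ 0) :
    p.roots.Nodup ↔ ∀ μ ∈ p.roots, (derivative p).eval μ ≠ 0 := by
  rw [Multiset.nodup_iff_count_le_one]
  refine ⟨fun h μ hμ h0 => ?_, fun h μ => ?_⟩
  · have := (one_lt_rootMultiplicity_iff_isRoot hp).2 ⟨(mem_roots hp).1 hμ, h0⟩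
    rw [← count_roots] at this
    exact absurd this (not_lt.2 (h μ))
  · by_contra! hlt
    rw [count_roots] at hlt
    obtain ⟨h1, h2⟩ := (one_lt_rootMultiplicity_iff_isRoot hp).1 hlt
    exact h μ ((mem_roots hp).2 h1) h2

end RatioDet

/-! ### The spectrum of a skew symmetric matrix, and openness of `O` -/

section Eigenvalues
open Polynomial

/-- The complexification of a real matrix. -/
abbrev toComplexMatrix {q : ℕ} (Z : Matrix (Fin q) (Fin q) ℝ) : Matrix (Fin q) (Fin q) ℂ :=
  Z.map (algebraMap ℝ ℂ)

theorem isHermitian_I_smul {q : ℕ} (Z : so q) :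
    (Complex.I • toComplexMatrix (Z : Matrix (Fin q) (Fin q) ℝ)).IsHermitian := by
  ext i j
  have h : (Z : Matrix (Fin q) (Fin q) ℝ) j i = -(Z : Matrix (Fin q) (Fin q) ℝ) i j :=
    congrFun (congrFun ((mem_so _).1 Z.2) i) j
  simp [h]

/-- The real numbers `λ` for which `-i λ` is an eigenvalue. -/
def frequency {q : ℕ} (Z : so q) : Fin q → ℝ := (isHermitian_I_smul Z).eigenvalues

theorem mem_complexEigenvalues_iff_spectrum {q : ℕ} (Z : Matrix (Fin q) (Fin q) ℝ) (μ : ℂ) :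
    μ ∈ complexEigenvalues Z ↔ μ ∈ spectrum ℂ (toComplexMatrix Z) := by
  rw [complexEigenvalues, mem_roots (Matrix.charpoly_monic _).ne_zero,
    Matrix.mem_spectrum_iff_isRoot_charpoly]

theorem mem_complexEigenvalues {q : ℕ} (Z : so q) (μ : ℂ) :
    μ ∈ complexEigenvalues (Z : Matrix (Fin q) (Fin q) ℝ) ↔
      ∃ k, μ = -Complex.I * frequency Z k := by
  have h : μ ∈ spectrum ℂ (toComplexMatrix (Z : Matrix (Fin q) (Fin q) ℝ)) ↔
      Complex.I * μ ∈ spectrum ℂ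
        (Complex.I • toComplexMatrix (Z : Matrix (Fin q) (Fin q) ℝ)) := by
    have := spectrum.smul_mem_smul_iff (R := ℂ) (s := μ)
      (a := toComplexMatrix (Z : Matrix (Fin q) (Fin q) ℝ))
      (r := Units.mk0 Complex.I Complex.I_ne_zero)
    exact this.symm
  rw [mem_complexEigenvalues_iff_spectrum, h, (isHermitian_I_smul Z).spectrum_eq_image_range]
  simp only [Set.mem_image, Set.mem_range, exists_exists_eq_and, frequency]
  refine exists_congr fun k => ⟨fun h => ?_, fun h => ?_⟩
  · have h2 := congrArg (-Complex.I * ·) h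
    simp only [← mul_assoc, neg_mul, Complex.I_mul_I, neg_neg, one_mul] at h2
    simpa using h2.symm
  · rw [h, ← mul_assoc]; simp

/-- A matrix and its transpose have the same characteristic polynomial, and here the transpose is
`-Z`. -/
theorem neg_mem_complexEigenvalues {q : ℕ} (Z : so q) {μ : ℂ}
    (h : μ ∈ complexEigenvalues (Z : Matrix (Fin q) (Fin q) ℝ)) :
    -μ ∈ complexEigenvalues (Z : Matrix (Fin q) (Fin q) ℝ) := by
  rw [complexEigenvalues, ← Matrix.charpoly_transpose] at h
  have hT : (toComplexMatrix (Z : Matrix (Fin q) (Fin q) ℝ)).transpose =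
      -toComplexMatrix (Z : Matrix (Fin q) (Fin q) ℝ) := by
    rw [← Matrix.transpose_map, (mem_so _).1 Z.2]; ext i j; simp
  rw [hT, mem_roots (Matrix.charpoly_monic _).ne_zero,
    ← Matrix.mem_spectrum_iff_isRoot_charpoly, ← spectrum.neg_eq] at h
  exact (mem_complexEigenvalues_iff_spectrum _ _).2 h

theorem card_complexEigenvalues {q : ℕ} (Z : Matrix (Fin q) (Fin q) ℝ) :
    (complexEigenvalues Z).card = q := by
  rw [complexEigenvalues, IsAlgClosed.card_roots_eq_natDegree,
    Matrix.charpoly_natDegree_eq_dim, Fintype.card_fin]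

/-- The positive frequencies of a skew symmetric matrix. -/
def positiveFrequencies {q : ℕ} (Z : so q) : Finset ℝ :=
  (Finset.univ.image (frequency Z)).filter (0 < ·)

theorem card_image_frequency {q : ℕ} (Z : so q)
    (h : (complexEigenvalues (Z : Matrix (Fin q) (Fin q) ℝ)).Nodup) :
    (Finset.univ.image (frequency Z)).card = q := by
  have h1 : (complexEigenvalues (Z : Matrix (Fin q) (Fin q) ℝ)).toFinset =
      (Finset.univ.image (frequency Z)).image (fun x : ℝ => -Complex.I * x) := by
    ext μ
    simp only [Multiset.mem_toFinset, mem_complexEigenvalues, Finset.mem_image, Finset.mem_univ,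
      true_and, exists_exists_eq_and]
    exact exists_congr fun k => eq_comm
  have h2 := Multiset.toFinset_card_of_nodup h
  rw [card_complexEigenvalues, h1, Finset.card_image_of_injective] at h2
  · exact h2
  · intro x y hxy
    simpa using hxy

theorem neg_frequency {q : ℕ} (Z : so q) (k : Fin q) : ∃ l, frequency Z l = -frequency Z k := by
  obtain ⟨l, hl⟩ := (mem_complexEigenvalues Z _).1
    (neg_mem_complexEigenvalues Z ((mem_complexEigenvalues Z _).2 ⟨k, rfl⟩))
  refine ⟨l, ?_⟩
  rw [← mul_neg] at hl
  have := mul_left_cancel₀ (neg_ne_zero.2 Complex.I_ne_zero) hl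
  exact_mod_cast this.symm

/-- Negation pairs the positive elements with the negative ones. Applied to the frequencies, this
yields both the count `q / 2` and the parity criterion for the eigenvalue `0`. -/
theorem card_eq_two_mul_card_pos {S : Finset ℝ} (hS : ∀ x ∈ S, -x ∈ S) :
    S.card = 2 * (S.filter (0 < ·)).card + if (0 : ℝ) ∈ S then 1 else 0 := by
  have h1 : (S.filter (· < 0)).card = (S.filter (0 < ·)).card := by
    refine Finset.card_bij (fun x _ => -x) ?_ ?_ ?_
    · intro x hx
      simp only [Finset.mem_filter] at hx ⊢
      exact ⟨hS x hx.1, by linarith [hx.2]⟩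
    · intro x _ y _ h; simpa using h
    · intro x hx
      simp only [Finset.mem_filter] at hx
      exact ⟨-x, by simp [hS x hx.1, hx.2], by simp⟩
  have h2 : (S.filter (· = 0)).card = if (0 : ℝ) ∈ S then 1 else 0 := by
    rw [Finset.filter_eq']; split_ifs <;> simp
  have h3 := Finset.card_filter_add_card_filter_not (s := S) (fun x : ℝ => 0 < x)
  have h4 := Finset.card_filter_add_card_filter_not (s := S.filter (fun x : ℝ => ¬ 0 < x))
    (fun x : ℝ => x = 0)
  have h5 : (S.filter (fun x : ℝ => ¬ 0 < x)).filter (fun x => x = 0) = S.filter (· = 0) := by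
    ext x; simp only [Finset.mem_filter, not_lt]; constructor
    · tauto
    · rintro ⟨h, rfl⟩; simp [h]
  have h6 : (S.filter (fun x : ℝ => ¬ 0 < x)).filter (fun x => ¬ x = 0) = S.filter (· < 0) := by
    ext x; simp only [Finset.mem_filter, not_lt, and_assoc, ← lt_iff_le_and_ne]
  rw [h5, h6, h1, h2] at h4
  omega

theorem card_positiveFrequencies {q : ℕ} (Z : so q)
    (h : (complexEigenvalues (Z : Matrix (Fin q) (Fin q) ℝ)).Nodup) :
    (positiveFrequencies Z).card = q / 2 ∧
      ((0 : ℂ) ∈ complexEigenvalues (Z : Matrix (Fin q) (Fin q) ℝ) ↔ Odd q) := by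
  have h1 := card_eq_two_mul_card_pos (S := Finset.univ.image (frequency Z)) (by
    intro x hx
    simp only [Finset.mem_image, Finset.mem_univ, true_and] at hx ⊢
    obtain ⟨k, rfl⟩ := hx
    exact neg_frequency Z k)
  rw [card_image_frequency Z h] at h1
  have h2 : (0 : ℂ) ∈ complexEigenvalues (Z : Matrix (Fin q) (Fin q) ℝ) ↔
      (0 : ℝ) ∈ Finset.univ.image (frequency Z) := by
    rw [mem_complexEigenvalues]
    simp [eq_comm]
  rw [h2, positiveFrequencies, Nat.odd_iff]
  split_ifs at h1 with h0
  · simp only [h0, true_iff]; omega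
  · simp only [h0, false_iff]; omega

/-- With simple spectrum, `0` is an eigenvalue only for odd `q`, and then a simple one, so dividing
by `X` removes exactly the root `0`. Without this removal the eigenvalue `0 = s · 0` would make
`ratioDet` vanish identically for odd `q`. -/
theorem eval_reducedCharpoly_eq_zero {q : ℕ} (Z : so q)
    (h : (complexEigenvalues (Z : Matrix (Fin q) (Fin q) ℝ)).Nodup) (ν : ℂ) :
    (reducedCharpoly (toComplexMatrix (Z : Matrix (Fin q) (Fin q) ℝ))).eval ν = 0 ↔
      ν ∈ complexEigenvalues (Z : Matrix (Fin q) (Fin q) ℝ) ∧ ν ≠ 0 := by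
  have hne : (toComplexMatrix (Z : Matrix (Fin q) (Fin q) ℝ)).charpoly ≠ 0 :=
    (Matrix.charpoly_monic _).ne_zero
  have h0 := (card_positiveFrequencies Z h).2
  unfold reducedCharpoly
  split_ifs with hq
  · have : ν ∈ complexEigenvalues (Z : Matrix (Fin q) (Fin q) ℝ) ↔ _ := mem_roots hne
    rw [this, IsRoot.def, iff_self_and]
    rintro hν rfl
    exact (Nat.not_odd_iff_even.2 hq) (h0.1 (this.2 hν))
  · have hz := h0.2 (Nat.not_even_iff_odd.1 hq)
    have hd := (nodup_roots_iff_derivative hne).1 h 0 hz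
    set χ := (toComplexMatrix (Z : Matrix (Fin q) (Fin q) ℝ)).charpoly with hχ
    have hfac : χ = X * χ.divX := by
      have h1 := X_mul_divX_add χ
      rw [coeff_zero_eq_eval_zero, ((mem_roots hne).1 hz : χ.eval 0 = 0)] at h1
      simpa using h1.symm
    have hd0 : χ.divX.eval 0 ≠ 0 := by
      intro hc
      apply hd
      rw [hfac]
      simp [hc]
    have : ν ∈ complexEigenvalues (Z : Matrix (Fin q) (Fin q) ℝ) ↔ _ := mem_roots hne
    rw [this, IsRoot.def, ← hχ]
    conv_rhs => rw [hfac]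
    simp only [eval_mul, eval_X, mul_eq_zero]
    constructor
    · intro h; exact ⟨Or.inr h, by rintro rfl; exact hd0 h⟩
    · rintro ⟨h | h, h'⟩
      · exact absurd h h'
      · exact h

theorem ratioDet_ne_zero_iff {q : ℕ} [NeZero q] (Z : so q) (s : ℝ) :
    ratioDet s (Z : Matrix (Fin q) (Fin q) ℝ) ≠ 0 ↔
      (complexEigenvalues (Z : Matrix (Fin q) (Fin q) ℝ)).Nodup ∧
      ∀ μ ∈ complexEigenvalues (Z : Matrix (Fin q) (Fin q) ℝ),
        s * μ ∈ complexEigenvalues (Z : Matrix (Fin q) (Fin q) ℝ) → s * μ = 0 := by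
  have hC : ratioDet s (Z : Matrix (Fin q) (Fin q) ℝ) ≠ 0 ↔
      ratioDet (s : ℂ) (toComplexMatrix (Z : Matrix (Fin q) (Fin q) ℝ)) ≠ 0 := by
    have := ratioDet_map (algebraMap ℝ ℂ) s (Z : Matrix (Fin q) (Fin q) ℝ)
    rw [show ((s : ℂ)) = algebraMap ℝ ℂ s from rfl, this]
    simp
  -- The first factor is rewritten as a polynomial in `Z` itself, so that spectral mapping applies
  -- to both factors with the same eigenvalues.
  have hs : aeval ((s : ℂ) • toComplexMatrix (Z : Matrix (Fin q) (Fin q) ℝ))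
      (reducedCharpoly (toComplexMatrix (Z : Matrix (Fin q) (Fin q) ℝ))) =
      aeval (toComplexMatrix (Z : Matrix (Fin q) (Fin q) ℝ))
        ((reducedCharpoly (toComplexMatrix (Z : Matrix (Fin q) (Fin q) ℝ))).comp
          (C (s : ℂ) * X)) := by
    rw [aeval_comp]
    simp [Algebra.smul_def]
  rw [hC, ratioDet, mul_ne_zero_iff, hs, det_aeval_ne_zero_iff, det_aeval_ne_zero_iff,
    ← nodup_roots_iff_derivative (Matrix.charpoly_monic _).ne_zero, and_comm]
  refine and_congr_right fun hn => ?_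
  refine forall₂_congr fun μ hμ => ?_
  rw [eval_comp, eval_mul, eval_C, eval_X, Ne, eval_reducedCharpoly_eq_zero Z hn]
  tauto

theorem mem_soRatio_iff {q m : ℕ} [NeZero q] (hm : 2 ≤ m) (Z : so q) :
    Z ∈ soRatio q m ↔ ratioDet (1 / m : ℝ) (Z : Matrix (Fin q) (Fin q) ℝ) ≠ 0 := by
  rw [ratioDet_ne_zero_iff]
  refine and_congr_right fun hn => ?_
  have hm0 : (m : ℂ) ≠ 0 := by norm_cast; omega
  have hm1 : (m : ℂ) ≠ 1 := by norm_cast; omega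
  push_cast
  constructor
  · intro h μ hμ hν
    by_contra h0
    have hμ0 : μ ≠ 0 := by rintro rfl; simp at h0
    refine (h μ hμ _ hν ?_ hμ0 h0).1 ?_
    · intro he
      field_simp at he
      rw [he] at hm1
      simp at hm1
    · field_simp
  · intro h μ hμ ν hν _ hμ0 hν0
    constructor
    · intro he
      have : ν = 1 / m * μ := by field_simp at he ⊢; rw [he]
      exact hν0 (this ▸ h μ hμ (this ▸ hν))
    · intro he
      -- Ratio `-m` reduces to ratio `m` because `-μ` is an eigenvalue too; hence one determinant
      -- per `m` suffices.
      have : ν = 1 / m * (-μ) := by field_simp at he ⊢; rw [he]; ring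
      exact hν0 (this ▸ h _ (neg_mem_complexEigenvalues Z hμ) (this ▸ hν))

theorem mem_soGeneric_iff {q : ℕ} [NeZero q] (Z : so q) :
    Z ∈ soGeneric q ↔ ∀ s ∈ insert (0 : ℝ) (Set.range fun n : ℕ => 1 / ((n : ℝ) + 2)),
      ratioDet s (Z : Matrix (Fin q) (Fin q) ℝ) ≠ 0 := by
  have key : ∀ n : ℕ, Z ∈ soRatio q (n + 2) ↔
      ratioDet (1 / ((n : ℝ) + 2)) (Z : Matrix (Fin q) (Fin q) ℝ) ≠ 0 := by
    intro n
    rw [mem_soRatio_iff (by omega)]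
    push_cast
    rfl
  simp only [soGeneric, Set.mem_iInter, Set.forall_mem_insert, Set.forall_mem_range]
  constructor
  · intro h
    refine ⟨?_, fun n => (key n).1 (h _ (by omega))⟩
    rw [ratioDet_ne_zero_iff]
    -- At `s = 0` the ratio condition is vacuous, as `0 * μ = 0`; only the distinctness of the
    -- eigenvalues remains.
    exact ⟨(h 2 le_rfl).1, by simp⟩
  · rintro ⟨_, h⟩ m hm
    obtain ⟨n, rfl⟩ := Nat.exists_eq_add_of_le' hm
    exact (key n).2 (h n)

theorem isOpen_soGeneric (q : ℕ) [NeZero q] : IsOpen (soGeneric q) := by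
  let K : Set ℝ := insert (0 : ℝ) (Set.range fun n : ℕ => 1 / ((n : ℝ) + 2))
  have hK : IsCompact K := by
    refine Filter.Tendsto.isCompact_insert_range ?_
    exact tendsto_const_nhds.div_atTop
      (Filter.tendsto_atTop_add_const_right _ _ tendsto_natCast_atTop_atTop)
  have : CompactSpace K := isCompact_iff_compactSpace.1 hK
  have hcl : IsClosed {x : K × so q |
      ratioDet (x.1 : ℝ) (x.2 : Matrix (Fin q) (Fin q) ℝ) = 0} := by
    have h : Continuous fun x : K × so q =>
        ((x.1 : ℝ), (x.2 : Matrix (Fin q) (Fin q) ℝ)) :=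
      (continuous_subtype_val.comp continuous_fst).prodMk
        ((isInducing_so q).continuous.comp continuous_snd)
    exact isClosed_eq ((continuous_ratioDet q).comp h) continuous_const
  -- The complement of `O` is the projection of the closed zero locus along the compact factor `K`.
  have := (isClosedMap_snd_of_compactSpace _ hcl).isOpen_compl
  convert this using 1
  ext Z
  rw [mem_soGeneric_iff]
  simp [K]

end Eigenvalues

/-! ### Measure zero, density and conjugation invariance of `O` -/

section Generic
open Polynomial MeasureTheory

theorem countable_line_notMem_soGeneric {q : ℕ} [NeZero q] {Z : so q} (hZ : Z ∈ soGeneric q)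
    (U : so q) : {t : ℝ | Z + t • U ∉ soGeneric q}.Countable := by
  have hK : (insert (0 : ℝ) (Set.range fun n : ℕ => 1 / ((n : ℝ) + 2))).Countable :=
    (Set.countable_range _).insert _
  choose p hp using fun s : ℝ => exists_ratioDet_line s
    (Z : Matrix (Fin q) (Fin q) ℝ) (U : Matrix (Fin q) (Fin q) ℝ)
  refine (hK.biUnion (t := fun s _ => {t : ℝ | ratioDet s ((Z : Matrix (Fin q) (Fin q) ℝ) +
    t • (U : Matrix (Fin q) (Fin q) ℝ)) = 0}) ?_).mono ?_
  · intro s hs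
    -- The polynomial is nonzero because its value at `t = 0` is `ratioDet s Z`, with `Z` in `O`.
    have h0 : p s ≠ 0 := by
      intro h
      have h1 := hp s 0
      rw [h, zero_smul, add_zero, eval_zero] at h1
      exact (mem_soGeneric_iff Z).1 hZ s hs h1
    refine ((p s).roots.toFinset.finite_toSet.subset ?_).countable
    intro t ht
    simp only [Set.mem_ofPred_eq, hp] at ht
    simpa [h0] using ht
  · intro t ht
    simp only [Set.mem_ofPred_eq, mem_soGeneric_iff, not_forall, not_not] at ht
    obtain ⟨s, hs, h⟩ := ht
    exact Set.mem_biUnion hs h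

/-- By Fubini for the map `(u, t) ↦ t • u`, for almost every `t` the set of `u` with `t • u ∈ A` is
null. One such `t ≠ 0` is enough, since scaling by `t` multiplies volume by a nonzero factor. -/
theorem volume_eq_zero_of_countable_lines {n : ℕ} {A : Set (Fin n → ℝ)} (hA : MeasurableSet A)
    (h : ∀ u, {t : ℝ | t • u ∈ A}.Countable) : volume A = 0 := by
  have hm : MeasurableSet {x : (Fin n → ℝ) × ℝ | x.2 • x.1 ∈ A} :=
    (measurable_snd.smul measurable_fst) hA
  have h1 : ∀ᵐ u : Fin n → ℝ, ∀ᵐ t : ℝ, t • u ∉ A :=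
    Filter.Eventually.of_forall fun u => by
      simpa [ae_iff] using (h u).measure_zero volume
  rw [Measure.ae_ae_comm (p := fun (u : Fin n → ℝ) (t : ℝ) => t • u ∉ A) hm.compl] at h1
  have h2 : ∀ᵐ t : ℝ, t ≠ 0 := by simp [ae_iff]
  obtain ⟨t, ht, ht0⟩ := (h1.and h2).exists
  have h3 : volume ((fun x : Fin n → ℝ => t • x) ⁻¹' A) = 0 := by
    simp only [ae_iff, not_not] at ht
    exact ht
  rw [Measure.addHaar_preimage_smul volume ht0, mul_eq_zero] at h3
  refine h3.resolve_left ?_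
  simp [ht0]

/-- A general linear `f` covers both uses: the identity of `so q`, and the inclusion of a subspace
`W`. -/
theorem isLebesgueNull_notMem_soGeneric {q : ℕ} [NeZero q] {V : Type*} [AddCommGroup V]
    [Module ℝ V] (f : V →ₗ[ℝ] so q) (h : ∃ v, f v ∈ soGeneric q) :
    IsLebesgueNull {v | f v ∉ soGeneric q} := by
  obtain ⟨v, hv⟩ := h
  intro b
  let l : (Fin (Module.finrank ℝ V) → ℝ) →ₗ[ℝ] so q := f ∘ₗ b.equivFun.symm.toLinearMap
  have hl : Continuous l := LinearMap.continuous_of_finiteDimensional l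
  have h1 : b.equivFun '' {v | f v ∉ soGeneric q} = l ⁻¹' (soGeneric q)ᶜ := by
    ext x
    constructor
    · rintro ⟨v, hv, rfl⟩
      simpa [l] using hv
    · intro hx
      exact ⟨b.equivFun.symm x, hx, b.equivFun.apply_symm_apply x⟩
  -- Translating the good point `v` to the origin turns lines through `v` into lines through `0`.
  rw [h1, ← measure_preimage_add volume (b.equivFun v)]
  refine volume_eq_zero_of_countable_lines ?_ fun u => ?_
  · exact ((isOpen_soGeneric q).isClosed_compl.preimage
      (hl.comp (continuous_const.add continuous_id))).measurableSet
  · convert countable_line_notMem_soGeneric hv (l u) using 2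
    ext t
    change l (b.equivFun v + t • u) ∉ soGeneric q ↔ _
    rw [map_add, map_smul]
    simp [l]

theorem dense_soGeneric {q : ℕ} [NeZero q] (h : (soGeneric q).Nonempty) :
    Dense (soGeneric q) := by
  obtain ⟨Y, hY⟩ := h
  intro Z
  have hd := (countable_line_notMem_soGeneric hY (Z - Y)).dense_compl ℝ
  have hc : Continuous fun t : ℝ => Y + t • (Z - Y) := by fun_prop
  have h1 := image_closure_subset_closure_image hc ⟨1, hd 1, rfl⟩
  refine closure_mono ?_ (by simpa using h1)
  rintro _ ⟨t, ht, rfl⟩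
  simpa using ht

theorem complexEigenvalues_soConj {q : ℕ} (g : Matrix.orthogonalGroup (Fin q) ℝ) (Z : so q) :
    complexEigenvalues (soConj g Z : Matrix (Fin q) (Fin q) ℝ) =
      complexEigenvalues (Z : Matrix (Fin q) (Fin q) ℝ) := by
  have h : ((g⁻¹ : Matrix.orthogonalGroup (Fin q) ℝ) : Matrix (Fin q) (Fin q) ℝ) * g = 1 :=
    congrArg Subtype.val (inv_mul_cancel g)
  have h1 : (soConj g Z : Matrix (Fin q) (Fin q) ℝ).charpoly =
      (Z : Matrix (Fin q) (Fin q) ℝ).charpoly := by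
    trans ((g : Matrix (Fin q) (Fin q) ℝ) * Z *
      ((g⁻¹ : Matrix.orthogonalGroup (Fin q) ℝ) : Matrix (Fin q) (Fin q) ℝ)).charpoly
    · rfl
    · rw [Matrix.charpoly_mul_comm, ← mul_assoc, h, one_mul]
  rw [complexEigenvalues, complexEigenvalues, Matrix.charpoly_map, h1, Matrix.charpoly_map]

theorem soConj_mem_soGeneric {q : ℕ} (g : Matrix.orthogonalGroup (Fin q) ℝ) (Z : so q) :
    soConj g Z ∈ soGeneric q ↔ Z ∈ soGeneric q := by
  simp only [soGeneric, Set.mem_iInter, soRatio, complexEigenvalues_soConj, Set.mem_ofPred_eq]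

theorem image_soConj_soGeneric {q : ℕ} (g : Matrix.orthogonalGroup (Fin q) ℝ) :
    soConj g '' soGeneric q = soGeneric q := by
  ext Z
  constructor
  · rintro ⟨Y, hY, rfl⟩
    exact (soConj_mem_soGeneric g Y).2 hY
  · intro hZ
    exact ⟨(soConj g).symm Z, (soConj_mem_soGeneric g _).1 (by simpa using hZ), by simp⟩

/-! ### An explicit element of `O` -/

/-- A real skew symmetric matrix with antidiagonal entries `w`. -/
theorem antidiagonal_mem_so {q : ℕ} {w : Fin q → ℝ} (hw : ∀ i, w i.rev = -w i) :
    (Matrix.of fun i j => if j = i.rev then w i else 0) ∈ so q := by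
  rw [mem_so]
  ext i j
  simp only [Matrix.transpose_apply, Matrix.of_apply, Matrix.neg_apply]
  by_cases h : i = j.rev
  · subst h
    simp [hw]
  · have h' : j ≠ i.rev := by rintro rfl; simp at h
    simp [h, h']

theorem mem_complexEigenvalues_antidiagonal {q : ℕ} {w : Fin q → ℝ}
    (hw : ∀ i, w i.rev = -w i) (k : Fin q) : Complex.I * w k ∈
      complexEigenvalues (Matrix.of fun i j : Fin q => if j = i.rev then w i else 0) := by
  rw [mem_complexEigenvalues_iff_spectrum, ← Matrix.spectrum_toLin',
    ← Module.End.hasEigenvalue_iff_mem_spectrum]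
  -- The eigenvector is `e_k + i e_{rev k}`. At the middle index of an odd size the first branch
  -- wins, giving `e_k`, which is consistent since `w k = 0` there.
  let v : Fin q → ℂ := fun i => if i = k then 1 else if i = k.rev then Complex.I else 0
  have hv : v ≠ 0 := fun h => by
    have := congrFun h k
    simp [v] at this
  refine Module.End.hasEigenvalue_of_hasEigenvector (x := v) ⟨?_, hv⟩
  rw [Module.End.mem_eigenspace_iff]
  ext i
  have h1 : Matrix.toLin' (toComplexMatrix
      (Matrix.of fun i j : Fin q => if j = i.rev then w i else 0)) v i =
      (w i : ℂ) * v i.rev := by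
    rw [Matrix.toLin'_apply, Matrix.mulVec, dotProduct, Finset.sum_eq_single i.rev]
    · simp
    · intro j _ hj; simp [hj]
    · simp
  rw [h1]
  simp only [v, Pi.smul_apply, smul_eq_mul]
  have hfix : k.rev = k → w k = 0 := fun h => by
    have := hw k
    rw [h] at this
    linarith
  by_cases hik : i = k
  · subst hik
    by_cases hr : i.rev = i
    · simp [hfix hr]
    · simp [hr, mul_comm]
  · by_cases hir : i = k.rev
    · subst hir
      have : k.rev ≠ k := hik
      simp [hw, this]
      linear_combination (-(w k : ℂ)) * Complex.I_mul_I
    · have h2 : i.rev ≠ k := by rintro rfl; simp at hir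
      have h3 : i.rev ≠ k.rev := by simpa using hik
      simp [hik, hir, h2, h3]

theorem complexEigenvalues_antidiagonal {q : ℕ} {w : Fin q → ℝ}
    (hw : ∀ i, w i.rev = -w i) (hinj : Function.Injective w) :
    complexEigenvalues (Matrix.of fun i j : Fin q => if j = i.rev then w i else 0) =
      Finset.univ.val.map fun k => Complex.I * (w k : ℂ) := by
  symm
  refine Multiset.eq_of_le_of_card_le ?_ (by rw [card_complexEigenvalues]; simp)
  rw [Multiset.le_iff_subset]
  · intro μ hμ
    obtain ⟨k, _, rfl⟩ := Multiset.mem_map.1 hμ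
    exact mem_complexEigenvalues_antidiagonal hw k
  · refine Finset.univ.nodup.map fun k l h => hinj ?_
    simpa using h

theorem soGeneric_nonempty (q : ℕ) : (soGeneric q).Nonempty := by
  let c : Fin q → ℤ := fun i => 2 * (i : ℤ) - ((q : ℤ) - 1)
  have hc : ∀ i, |c i| < q := fun i => by
    have := i.2
    simp only [c, abs_lt]; omega
  -- The integers `c i` are distinct, antisymmetric under reversal and smaller than `q` in absolute
  -- value. Pushing them away from `0` by `q` puts every nonzero `|w i|` strictly between `q` and
  -- `2q`, so all ratios have absolute value below `2`.
  let w : Fin q → ℝ := fun i => ((c i + q * (c i).sign : ℤ) : ℝ)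
  have hrev : ∀ i, c i.rev = -c i := fun i => by
    have := i.2
    simp only [c, Fin.val_rev]; omega
  have hw : ∀ i, w i.rev = -w i := fun i => by
    simp only [w, hrev, Int.sign_neg]; push_cast; ring
  have hval : ∀ i, (c i = 0 ∧ w i = 0) ∨ (0 < c i ∧ w i = c i + q) ∨
      (c i < 0 ∧ w i = c i - q) := fun i => by
    rcases lt_trichotomy (c i) 0 with h | h | h
    · right; right; refine ⟨h, ?_⟩; simp only [w, Int.sign_eq_neg_one_of_neg h]; push_cast; ring
    · left; refine ⟨h, ?_⟩; simp [w, h]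
    · right; left; refine ⟨h, ?_⟩; simp only [w, Int.sign_eq_one_of_pos h]; push_cast; ring
  have hinj : Function.Injective w := by
    intro i j h
    have hij : c i = c j := by
      simp only [w, Int.cast_inj] at h
      have hi := abs_lt.1 (hc i)
      have hj := abs_lt.1 (hc j)
      rcases lt_trichotomy (c i) 0 with h1 | h1 | h1 <;>
      rcases lt_trichotomy (c j) 0 with h2 | h2 | h2 <;>
      simp only [h1, h2, Int.sign_eq_neg_one_of_neg, Int.sign_eq_one_of_pos, Int.sign_zero]
        at h <;> omega
    simp only [c] at hij
    ext; omega
  have habs : ∀ i, w i = 0 ∨ ((q : ℝ) < |w i| ∧ |w i| < 2 * q) := fun i => by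
    have hi := abs_lt.1 (hc i)
    have h1 : (-(q : ℝ)) < c i := by exact_mod_cast hi.1
    have h2 : (c i : ℝ) < q := by exact_mod_cast hi.2
    rcases hval i with ⟨_, h⟩ | ⟨h', h⟩ | ⟨h', h⟩
    · exact Or.inl h
    · have h3 : (0 : ℝ) < c i := by exact_mod_cast h'
      right; rw [h, abs_of_pos (by linarith)]; constructor <;> linarith
    · have h3 : (c i : ℝ) < 0 := by exact_mod_cast h'
      right; rw [h, abs_of_neg (by linarith)]; constructor <;> linarith
  refine ⟨⟨_, antidiagonal_mem_so hw⟩, ?_⟩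
  simp only [soGeneric, Set.mem_iInter, soRatio, Set.mem_ofPred_eq,
    complexEigenvalues_antidiagonal hw hinj]
  intro m hm
  refine ⟨Finset.univ.nodup.map fun k l h => hinj (by simpa using h), ?_⟩
  simp only [Multiset.mem_map, Finset.mem_val, Finset.mem_univ, true_and,
    forall_exists_index, forall_apply_eq_imp_iff]
  intro k l _ hk hl
  have hk' : w k ≠ 0 := fun h => hk (by simp [h])
  have hl' : w l ≠ 0 := fun h => hl (by simp [h])
  have h1 := (habs k).resolve_left hk'
  have h2 := (habs l).resolve_left hl'
  have hne : ‖Complex.I * (w k : ℂ) / (Complex.I * w l)‖ ≠ m := by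
    rw [norm_div, norm_mul, norm_mul, Complex.norm_real, Complex.norm_real, Complex.norm_I,
      one_mul, one_mul, Real.norm_eq_abs, Real.norm_eq_abs]
    intro h
    have h3 : |w l| ≠ 0 := abs_ne_zero.2 hl'
    rw [div_eq_iff h3] at h
    have hm' : (2 : ℝ) ≤ m := by exact_mod_cast hm
    nlinarith [abs_nonneg (w l)]
  constructor
  · intro h; apply hne; rw [h]; simp
  · intro h; apply hne; rw [h]; simp

/-! ### The Grassmannian -/

theorem isOpen_grassmannGeneric (p q : ℕ) [NeZero q] : IsOpen (grassmannGeneric p q) := by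
  change IsOpen (Grassmann.ofFrame p (so q) ⁻¹' grassmannGeneric p q)
  -- In the quotient topology, openness is tested on frames: a span meets `O` when some fixed
  -- coefficient vector `c` gives a combination in `O`, an open condition for each `c`.
  have h : Grassmann.ofFrame p (so q) ⁻¹' grassmannGeneric p q =
      ⋃ c : Fin p → ℝ, {v | ∑ i, c i • v.1 i ∈ soGeneric q} := by
    ext v
    simp only [Set.mem_preimage, grassmannGeneric, Grassmann.ofFrame, Set.mem_ofPred_eq,
      Set.mem_iUnion]
    constructor
    · rintro ⟨Z, hZ, hO⟩
      obtain ⟨c, rfl⟩ := (Submodule.mem_span_range_iff_exists_fun ℝ).1 hZ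
      exact ⟨c, hO⟩
    · rintro ⟨c, hc⟩
      exact ⟨_, (Submodule.mem_span_range_iff_exists_fun ℝ).2 ⟨c, rfl⟩, hc⟩
  rw [h]
  refine isOpen_iUnion fun c => (isOpen_soGeneric q).preimage ?_
  refine continuous_finsetSum _ fun i _ => ?_
  exact ((continuous_apply i).comp continuous_subtype_val).const_smul (c i)

theorem surjective_ofFrame (p : ℕ) (V : Type*) [AddCommGroup V] [Module ℝ V]
    [FiniteDimensional ℝ V] : Function.Surjective (Grassmann.ofFrame p V) := by
  rintro ⟨W, hW⟩
  let b := Module.finBasisOfFinrankEq ℝ W hW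
  refine ⟨⟨fun i => (b i : V), ?_⟩, ?_⟩
  · exact b.linearIndependent.map' W.subtype W.ker_subtype
  · refine Subtype.ext ?_
    have : Set.range (fun i => (b i : V)) = W.subtype '' Set.range b := by
      rw [← Set.range_comp]; rfl
    change Submodule.span ℝ (Set.range fun i => (b i : V)) = W
    rw [this, Submodule.span_image, b.span_eq, Submodule.map_top, Submodule.range_subtype]

theorem dense_grassmannGeneric {p q : ℕ} [NeZero q] (hp : 1 ≤ p) :
    Dense (grassmannGeneric p q) := by
  let i : Fin p := ⟨0, hp⟩
  have hopen : IsOpen {v : Fin p → so q | LinearIndependent ℝ v} :=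
    isOpen_setOfPred_linearIndependent
  -- Frames whose first vector lies in `O` are already dense, because evaluation at `i` is an open
  -- map on the open set of independent tuples.
  have h1 : Dense {v : {v : Fin p → so q // LinearIndependent ℝ v} | v.1 i ∈ soGeneric q} :=
    (dense_soGeneric (soGeneric_nonempty q)).preimage
      ((isOpenMap_eval i).comp hopen.isOpenEmbedding_subtypeVal.isOpenMap)
  have h2 := (surjective_ofFrame p (so q)).denseRange.dense_image
    (continuous_coinduced_rng (f := Grassmann.ofFrame p (so q))) h1
  refine h2.mono ?_
  rintro _ ⟨v, hv, rfl⟩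
  exact ⟨v.1 i, Submodule.subset_span ⟨i, rfl⟩, hv⟩

theorem image_map_soConj_grassmannGeneric {p q : ℕ} (g : Matrix.orthogonalGroup (Fin q) ℝ) :
    Grassmann.map (soConj g) '' grassmannGeneric p q = grassmannGeneric p q := by
  ext W
  constructor
  · rintro ⟨W, ⟨Z, hZ, hO⟩, rfl⟩
    exact ⟨soConj g Z, Submodule.mem_map_of_mem hZ, (soConj_mem_soGeneric g Z).2 hO⟩
  · rintro ⟨Z, hZ, hO⟩
    refine ⟨Grassmann.map (soConj g).symm W, ⟨(soConj g).symm Z,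
      Submodule.mem_map_of_mem hZ, (soConj_mem_soGeneric g _).1 (by simpa using hO)⟩, ?_⟩
    refine Subtype.ext ?_
    change (W.1.map _).map _ = W.1
    rw [← Submodule.map_comp]
    convert Submodule.map_id W.1
    ext1 x
    simp

end Generic

/-! ### The Levi-Civita connection along a central geodesic -/

theorem deriv_quadratic_zero (a b c : ℝ) :
    deriv (fun t : ℝ => a + t * b + t ^ 2 * c) 0 = b := by
  have h : HasDerivAt (fun t : ℝ => a + t * b + t ^ 2 * c)
      (0 + 1 * b + (2 * (0 : ℝ) ^ 1 * 1) * c) 0 :=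
    ((hasDerivAt_const _ a).add ((hasDerivAt_id (0 : ℝ)).mul_const b)).add
      (((hasDerivAt_id (0 : ℝ)).pow 2).mul_const c)
  rw [h.deriv]
  ring

/-- No differentiability is assumed: where `f` is not differentiable, `fderiv` takes the default
value `0`. The lemma can therefore be applied to Christoffel symbols without proving them smooth. -/
theorem fderiv_eq_zero_of_invariant {E F : Type*} [NormedAddCommGroup E] [NormedSpace ℝ E]
    [NormedAddCommGroup F] [NormedSpace ℝ F] {f : E → F} {c : E}
    (h : ∀ (y : E) (t : ℝ), f (y + t • c) = f y) (x : E) : fderiv ℝ f x c = 0 := by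
  by_cases hd : DifferentiableAt ℝ f x
  · rw [← hd.lineDeriv_eq_fderiv, lineDeriv]
    simp [h]
  · simp [fderiv_zero_of_not_differentiableAt hd]

namespace NilGroup

theorem metric_apply {q : ℕ} (W : Submodule ℝ (so q)) (x u v : NilGroup W) :
    metric W x u v = NilAlgebra.innerForm W (log W u - (1 / 2 : ℝ) • ⁅log W x, log W u⁆)
      (log W v - (1 / 2 : ℝ) • ⁅log W x, log W v⁆) := by
  have h : ∀ u : NilGroup W, log W (fderiv ℝ (fun y : NilGroup W => x⁻¹ * y) x u) =
      log W u - (1 / 2 : ℝ) • ⁅log W x, log W u⁆ := by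
    intro u
    rw [fderiv_mul_left]
    simp [bracketN, inv_def, sub_eq_add_neg, NilAlgebra.bracket_def]
  simp only [metric, ContinuousLinearMap.bilinearComp_apply, ContinuousLinearMap.comp_apply,
    ContinuousLinearEquiv.coe_coe, h]

/-- The coordinates of a point of `N_W`. -/
abbrev coordV {q : ℕ} (W : Submodule ℝ (so q)) (x : NilGroup W) : EuclideanSpace ℝ (Fin q) :=
  NilAlgebra.projV W (log W x)

abbrev coordW {q : ℕ} (W : Submodule ℝ (so q)) (x : NilGroup W) : W :=
  NilAlgebra.projW W (log W x)

theorem metric_eq {q : ℕ} (W : Submodule ℝ (so q)) (x u v : NilGroup W) :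
    metric W x u v = inner ℝ (coordV W u) (coordV W v) +
      inner ℝ (coordW W u - (1 / 2 : ℝ) • bracketL W (coordV W x) (coordV W u))
        (coordW W v - (1 / 2 : ℝ) • bracketL W (coordV W x) (coordV W v)) := by
  rw [metric_apply, NilAlgebra.innerForm_apply]
  simp [NilAlgebra.bracket_def]

theorem contDiff_metric {q : ℕ} (W : Submodule ℝ (so q)) : ContDiff ℝ ∞ (metric W) := by
  rw [contDiff_clm_apply_iff]
  intro u
  rw [contDiff_clm_apply_iff]
  intro v
  have h : ∀ u : NilGroup W, ContDiff ℝ ∞ fun x : NilGroup W =>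
      coordW W u - (1 / 2 : ℝ) • bracketL W (coordV W x) (coordV W u) := by
    intro u
    let l : NilGroup W →ₗ[ℝ] W := (bracketL W).flip (coordV W u) ∘ₗ
      (NilAlgebra.projV W : NilAlgebra W →ₗ[ℝ] _) ∘ₗ
      ((log W : NilGroup W →L[ℝ] NilAlgebra W) : NilGroup W →ₗ[ℝ] NilAlgebra W)
    exact contDiff_const.sub ((LinearMap.toContinuousLinearMap l).contDiff.const_smul (1 / 2 : ℝ))
  simp only [metric_eq]
  exact contDiff_const.add ((h u).inner ℝ (h v))

theorem fderiv_metric_apply {q : ℕ} (W : Submodule ℝ (so q)) (x a u v : NilGroup W) :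
    fderiv ℝ (metric W) x a u v = fderiv ℝ (fun y => metric W y u v) x a := by
  have h : HasFDerivAt (metric W) (fderiv ℝ (metric W) x) x :=
    ((contDiff_metric W).differentiable (by simp)).differentiableAt.hasFDerivAt
  have h1 : HasFDerivAt (fun y => metric W y u) _ x := h.clm_apply (hasFDerivAt_const u x)
  have h2 : HasFDerivAt (fun y => metric W y u v) _ x := h1.clm_apply (hasFDerivAt_const v x)
  rw [h2.fderiv]
  simp

theorem fderiv_metric_zero {q : ℕ} (W : Submodule ℝ (so q)) (a u v : NilGroup W) :
    fderiv ℝ (metric W) 0 a u v =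
      -(1 / 2 : ℝ) * (inner ℝ (bracketL W (coordV W a) (coordV W u)) (coordW W v) +
        inner ℝ (coordW W u) (bracketL W (coordV W a) (coordV W v))) := by
  have hd : DifferentiableAt ℝ (fun y => metric W y u v) 0 :=
    (((contDiff_metric W).clm_apply contDiff_const).clm_apply contDiff_const).differentiable
      (by simp) |>.differentiableAt
  rw [fderiv_metric_apply, ← hd.lineDeriv_eq_fderiv, lineDeriv]
  have h : (fun t : ℝ => metric W (0 + t • a) u v) = fun t : ℝ =>
      (inner ℝ (coordV W u) (coordV W v) + inner ℝ (coordW W u) (coordW W v)) +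
      t * (-(1 / 2 : ℝ) * (inner ℝ (bracketL W (coordV W a) (coordV W u)) (coordW W v) +
        inner ℝ (coordW W u) (bracketL W (coordV W a) (coordV W v)))) +
      t ^ 2 * ((1 / 4 : ℝ) * inner ℝ (bracketL W (coordV W a) (coordV W u))
        (bracketL W (coordV W a) (coordV W v))) := by
    funext t
    rw [metric_eq]
    simp only [coordV, coordW, zero_add, map_smul, LinearMap.smul_apply]
    simp only [inner_sub_left (E := W), inner_sub_right (E := W), real_inner_smul_left (F := W),
      real_inner_smul_right (F := W)]
    ring
  rw [h, deriv_quadratic_zero]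

/-- The base point enters the metric only through brackets, which do not see its central component.
-/
theorem metric_add_central {q : ℕ} (W : Submodule ℝ (so q)) {c : NilGroup W}
    (hc : coordV W c = 0) (x : NilGroup W) : metric W (x + c) = metric W x := by
  ext u v
  rw [metric_eq, metric_eq]
  have : coordV W (x + c) = coordV W x := by
    rw [coordV, map_add, map_add, show NilAlgebra.projV W (log W c) = 0 from hc, add_zero]
  rw [this]

theorem christoffel_add_central {q : ℕ} (W : Submodule ℝ (so q)) {c : NilGroup W}
    (hc : coordV W c = 0) (x u v : NilGroup W) :
    RiemChart.christoffel (metric W) (x + c) u v = RiemChart.christoffel (metric W) x u v := by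
  have h : fderiv ℝ (metric W) (x + c) = fderiv ℝ (metric W) x := by
    have h := fderiv_comp_add_right (𝕜 := ℝ) (f := metric W) (x := x) c
    rw [← h]
    simp only [metric_add_central W hc]
  rw [RiemChart.christoffel, RiemChart.christoffel, h, metric_add_central W hc]

theorem coordV_smul_eq_zero {q : ℕ} {W : Submodule ℝ (so q)} {c : NilGroup W}
    (hc : coordV W c = 0) (t : ℝ) : coordV W (t • c) = 0 := by
  rw [coordV, map_smul, map_smul, show NilAlgebra.projV W (log W c) = 0 from hc, smul_zero]

theorem fderiv_metric_central {q : ℕ} (W : Submodule ℝ (so q)) {c : NilGroup W}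
    (hc : coordV W c = 0) (x : NilGroup W) : fderiv ℝ (metric W) x c = 0 :=
  fderiv_eq_zero_of_invariant
    (fun y t => metric_add_central W (coordV_smul_eq_zero hc t) y) x

theorem christoffel_central_central {q : ℕ} (W : Submodule ℝ (so q)) {c : NilGroup W}
    (hc : coordV W c = 0) (x : NilGroup W) :
    RiemChart.christoffel (metric W) x c c = 0 := by
  have h : ∀ w, fderiv ℝ (metric W) x w c c = 0 := by
    intro w
    have hb : ∀ v, bracketL W v 0 = 0 := fun v => map_zero _
    -- A central vector has the same length at every point of the chart, so this term of the
    -- Christoffel symbol vanishes; the other two vanish by invariance.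
    have h : (fun y => metric W y c c) = fun _ => metric W 0 c c := by
      funext y
      simp only [metric_eq, hc, hb]
    rw [fderiv_metric_apply, h, fderiv_fun_const]
    rfl
  rw [RiemChart.christoffel, fderiv_metric_central W hc]
  have h2 : ((fderiv ℝ (metric W) x).flip c).flip c = 0 := by
    ext w
    simpa using h w
  rw [h2]
  simp

/-- Needed because `christoffel` uses `inverse`, which is `0` on non-invertible maps. The origin
suffices, since central invariance moves every point of the geodesic there. -/
theorem isInvertible_metric_zero {q : ℕ} (W : Submodule ℝ (so q)) :
    (metric W 0).IsInvertible := by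
  have hinj : Function.Injective (metric W 0 : NilGroup W →ₗ[ℝ] (NilGroup W →L[ℝ] ℝ)) := by
    rw [← LinearMap.ker_eq_bot, LinearMap.ker_eq_bot']
    intro u hu
    have h : metric W 0 u u = 0 := by
      have := congrArg (fun φ : NilGroup W →L[ℝ] ℝ => φ u) hu
      simpa using this
    rw [metric_eq] at h
    have h0 : coordV W (0 : NilGroup W) = 0 := by simp [coordV]
    rw [h0, map_zero, LinearMap.zero_apply, smul_zero, sub_zero] at h
    have h1 := real_inner_self_nonneg (x := coordV W u)
    have h2 := real_inner_self_nonneg (F := W) (x := coordW W u)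
    have h3 : coordV W u = 0 := inner_self_eq_zero (𝕜 := ℝ).1 (by linarith)
    have h4 : coordW W u = 0 := inner_self_eq_zero (𝕜 := ℝ) (E := W).1 (by linarith)
    exact (log W).injective (NilAlgebra.ext_proj (by simpa using h3) (by simpa using h4))
  have hdim : Module.finrank ℝ (NilGroup W) = Module.finrank ℝ (NilGroup W →L[ℝ] ℝ) := by
    rw [← Subspace.dual_finrank_eq (K := ℝ) (V := NilGroup W)]
    exact (LinearMap.toContinuousLinearMap (𝕜 := ℝ) (E := NilGroup W) (F' := ℝ)).finrank_eq
  refine ⟨(LinearEquiv.ofInjectiveOfFinrankEq _ hinj hdim).toContinuousLinearEquiv, ?_⟩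
  ext u v
  rfl

/-- The inclusion of `ℝ^q` into `N_W`. -/
def inclV {q : ℕ} (W : Submodule ℝ (so q)) : EuclideanSpace ℝ (Fin q) →L[ℝ] NilGroup W :=
  (exp W : NilAlgebra W →L[ℝ] NilGroup W) ∘L
    (ContinuousLinearMap.inl ℝ (EuclideanSpace ℝ (Fin q)) W :
      EuclideanSpace ℝ (Fin q) →L[ℝ] NilAlgebra W)

@[simp] theorem coordV_inclV {q : ℕ} (W : Submodule ℝ (so q)) (v : EuclideanSpace ℝ (Fin q)) :
    coordV W (inclV W v) = v := rfl

/-- The linear map `v + z ↦ Z v`. -/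
def rotation {q : ℕ} (W : Submodule ℝ (so q)) (Z : W) : NilGroup W →L[ℝ] NilGroup W :=
  inclV W ∘L
    LinearMap.toContinuousLinearMap
      (Matrix.toEuclideanLin ((Z : so q) : Matrix (Fin q) (Fin q) ℝ)) ∘L
    NilAlgebra.projV W ∘L (log W : NilGroup W →L[ℝ] NilAlgebra W)

theorem rotation_apply {q : ℕ} (W : Submodule ℝ (so q)) (Z : W) (u : NilGroup W) :
    rotation W Z u = inclV W
      (Matrix.toEuclideanLin ((Z : so q) : Matrix (Fin q) (Fin q) ℝ) (coordV W u)) := rfl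

@[simp] theorem coordV_rotation {q : ℕ} (W : Submodule ℝ (so q)) (Z : W) (u : NilGroup W) :
    coordV W (rotation W Z u) =
      Matrix.toEuclideanLin ((Z : so q) : Matrix (Fin q) (Fin q) ℝ) (coordV W u) := rfl

@[simp] theorem coordW_rotation {q : ℕ} (W : Submodule ℝ (so q)) (Z : W) (u : NilGroup W) :
    coordW W (rotation W Z u) = 0 := rfl

theorem inner_toEuclideanLin_skew {q : ℕ} (Z : so q) (v w : EuclideanSpace ℝ (Fin q)) :
    inner ℝ (Matrix.toEuclideanLin (Z : Matrix (Fin q) (Fin q) ℝ) v) w =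
      -inner ℝ (Matrix.toEuclideanLin (Z : Matrix (Fin q) (Fin q) ℝ) w) v := by
  conv_lhs => rw [real_inner_comm, ← LinearMap.adjoint_inner_left,
    ← Matrix.toEuclideanLin_conjTranspose_eq_adjoint,
    Matrix.conjTranspose_eq_transpose_of_trivial, (mem_so _).1 Z.2]
  simp

/-- The element of `N_W` with coordinates `(0, Z)`. -/
abbrev central {q : ℕ} (W : Submodule ℝ (so q)) (Z : W) : NilGroup W :=
  exp W (NilAlgebra.inclW W Z)

theorem coordV_central {q : ℕ} (W : Submodule ℝ (so q)) (Z : W) :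
    coordV W (central W Z) = 0 := rfl

theorem coordW_central {q : ℕ} (W : Submodule ℝ (so q)) (Z : W) :
    coordW W (central W Z) = Z := rfl

theorem christoffel_zero_central {q : ℕ} (W : Submodule ℝ (so q)) (Z : W) (u : NilGroup W) :
    RiemChart.christoffel (metric W) 0 (central W Z) u = -(1 / 2 : ℝ) • rotation W Z u ∧
    RiemChart.christoffel (metric W) 0 u (central W Z) = -(1 / 2 : ℝ) • rotation W Z u := by
  -- Both Christoffel symbols are dual to the functional `w ↦ -½⟨Zu, w⟩`; it arises from `⟨[v, w],
  -- Z⟩ = Zv · w` and the skewness of `Z`.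
  have key : ∀ φ : NilGroup W →L[ℝ] ℝ, (∀ w, φ w = -(1 / 2 : ℝ) *
      inner ℝ (Matrix.toEuclideanLin ((Z : so q) : Matrix (Fin q) (Fin q) ℝ) (coordV W u))
        (coordV W w)) → (metric W 0).inverse φ = -(1 / 2 : ℝ) • rotation W Z u := by
    intro φ hφ
    have h : φ = metric W 0 (-(1 / 2 : ℝ) • rotation W Z u) := by
      ext w
      rw [hφ, map_smul, smul_apply, metric_eq]
      have h0 : coordV W (0 : NilGroup W) = 0 := by simp [coordV]
      rw [h0, map_zero, LinearMap.zero_apply, LinearMap.zero_apply, smul_zero,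
        coordV_rotation, coordW_rotation, sub_zero, inner_zero_left (E := W), add_zero, smul_eq_mul]
    obtain ⟨e, he⟩ := isInvertible_metric_zero W
    rw [h, ← he, ContinuousLinearMap.inverse_equiv]
    simp
  have hb : ∀ v w, inner ℝ Z (bracketL W v w) =
      inner ℝ (Matrix.toEuclideanLin ((Z : so q) : Matrix (Fin q) (Fin q) ℝ) v) w := by
    intro v w
    rw [real_inner_comm (F := W)]
    exact inner_bracketV W v w Z
  have hb' : ∀ v w, inner ℝ (bracketL W v w) Z =
      inner ℝ (Matrix.toEuclideanLin ((Z : so q) : Matrix (Fin q) (Fin q) ℝ) v) w :=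
    fun v w => inner_bracketV W v w Z
  constructor <;> refine key _ fun w => ?_
  all_goals
    rw [smul_apply, sub_apply,
      add_apply, ContinuousLinearMap.flip_apply,
      ContinuousLinearMap.flip_apply, fderiv_metric_zero, fderiv_metric_zero, fderiv_metric_zero]
    simp only [coordV_central, coordW_central, map_zero, LinearMap.zero_apply,
      inner_zero_left (E := W), inner_zero_right (E := W), hb, hb',
      inner_toEuclideanLin_skew (Z : so q) (coordV W w), smul_eq_mul]
    ring

theorem deriv_centralGeodesic {q : ℕ} (W : Submodule ℝ (so q)) (Z : W) :
    deriv (centralGeodesic W Z) = fun _ => central W Z := by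
  funext t
  have h : centralGeodesic W Z = fun t => t • central W Z := by
    funext t; simp [centralGeodesic, central]
  rw [h]
  have := (hasDerivAt_id t).smul_const (central W Z)
  simpa using this.deriv

theorem centralGeodesic_eq {q : ℕ} (W : Submodule ℝ (so q)) (Z : W) (t : ℝ) :
    centralGeodesic W Z t = t • central W Z := by simp [centralGeodesic, central]

theorem isGeodesic_centralGeodesic {q : ℕ} (W : Submodule ℝ (so q)) (Z : W) :
    RiemChart.IsGeodesic (metric W) (centralGeodesic W Z) := by
  constructor
  · have h : centralGeodesic W Z = fun t => t • central W Z := funext (centralGeodesic_eq W Z)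
    rw [h]; fun_prop
  · intro t
    rw [RiemChart.covDeriv, deriv_centralGeodesic]
    simp [christoffel_central_central W (coordV_central W Z)]

theorem curvature_central {q : ℕ} (W : Submodule ℝ (so q)) (Z : W) (t : ℝ) (u : NilGroup W) :
    RiemChart.curvature (metric W) (t • central W Z) u (central W Z) (central W Z) =
      -((1 / 4 : ℝ) • rotation W Z (rotation W Z u)) := by
  have hc := coordV_central W Z
  have h1 : ∀ x u v, RiemChart.christoffel (metric W) (x + t • central W Z) u v =
      RiemChart.christoffel (metric W) x u v :=
    christoffel_add_central W (coordV_smul_eq_zero hc t)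
  -- Of the four curvature terms only `-Γ(Z, Γ(u, Z))` survives: this derivative is taken in a
  -- central direction, and the two other terms contain `Γ(Z, Z) = 0`.
  have h2 := fderiv_eq_zero_of_invariant
    (f := fun y => RiemChart.christoffel (metric W) y u (central W Z)) (c := central W Z)
    (fun y s => christoffel_add_central W (coordV_smul_eq_zero hc s) y u (central W Z))
    (t • central W Z)
  rw [RiemChart.curvature, h2]
  simp only [christoffel_central_central W hc]
  have h3 := fun u v => h1 0 u v
  simp only [zero_add] at h3
  have h4 : RiemChart.christoffel (metric W) 0 u 0 = 0 := by simp [RiemChart.christoffel]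
  rw [h3, h3, h3, (christoffel_zero_central W Z u).2, (christoffel_zero_central W Z _).1, h4]
  simp only [fderiv_fun_const, Pi.zero_apply, zero_apply, map_smul]
  module

theorem covDeriv_centralGeodesic {q : ℕ} (W : Submodule ℝ (so q)) (Z : W)
    (Y : ℝ → NilGroup W) :
    RiemChart.covDeriv (metric W) (centralGeodesic W Z) Y =
      fun t => deriv Y t - (1 / 2 : ℝ) • rotation W Z (Y t) := by
  funext t
  have h := christoffel_add_central W (coordV_smul_eq_zero (coordV_central W Z) t) 0
    (central W Z) (Y t)
  rw [zero_add] at h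
  rw [RiemChart.covDeriv, deriv_centralGeodesic, centralGeodesic_eq, h,
    (christoffel_zero_central W Z _).1]
  module

/-- In the chart, the Jacobi equation along a central geodesic is `Y'' = Z Y'`. -/
theorem isJacobiField_iff {q : ℕ} (W : Submodule ℝ (so q)) (Z : W) (Y : ℝ → NilGroup W) :
    RiemChart.IsJacobiField (metric W) (centralGeodesic W Z) Y ↔
      ContDiff ℝ ∞ Y ∧ ∀ t, deriv (deriv Y) t = rotation W Z (deriv Y t) := by
  refine and_congr_right fun hY => forall_congr' fun t => ?_
  have hd : Differentiable ℝ Y := hY.differentiable (by simp)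
  have hd' : Differentiable ℝ (deriv Y) :=
    ((contDiff_infty_iff_deriv.1 hY).2).differentiable (by simp)
  have h1 : deriv (fun t => deriv Y t - (1 / 2 : ℝ) • rotation W Z (Y t)) t =
      deriv (deriv Y) t - (1 / 2 : ℝ) • rotation W Z (deriv Y t) :=
    ((hd' t).hasDerivAt.sub
      (((rotation W Z).hasFDerivAt.comp_hasDerivAt t (hd t).hasDerivAt).const_smul
        (1 / 2 : ℝ))).deriv
  rw [covDeriv_centralGeodesic, covDeriv_centralGeodesic]
  beta_reduce
  rw [h1, deriv_centralGeodesic,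
    centralGeodesic_eq, curvature_central, ← sub_eq_zero (b := rotation W Z (deriv Y t))]
  -- The `¼ Z² Y` from the iterated covariant derivative cancels against the curvature term.
  have h2 : deriv (deriv Y) t - (1 / 2 : ℝ) • rotation W Z (deriv Y t) -
      (1 / 2 : ℝ) • rotation W Z (deriv Y t - (1 / 2 : ℝ) • rotation W Z (Y t)) +
      -((1 / 4 : ℝ) • rotation W Z (rotation W Z (Y t))) =
      deriv (deriv Y) t - rotation W Z (deriv Y t) := by
    rw [map_sub, map_smul]
    module
  rw [h2]

end NilGroup

/-! ### The scalar equation `f'' = μ f'` and the eigenvector decomposition -/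

theorem eq_zero_of_boundary {f f' : ℝ → ℂ} {μ : ℂ} {T : ℝ} (hf : ∀ t, HasDerivAt f (f' t) t)
    (hf' : ∀ t, HasDerivAt f' (μ * f' t) t) (h0 : f 0 = 0) (hT : f T = 0) (hT0 : T ≠ 0)
    (hμ : μ = 0 ∨ Complex.exp (μ * T) ≠ 1) (t : ℝ) : f t = 0 := by
  have hexp : ∀ t : ℝ, HasDerivAt (fun t : ℝ => Complex.exp (-μ * t))
      (Complex.exp (-μ * t) * (-μ * 1)) t := fun t =>
    ((hasDerivAt_id t).ofReal_comp.const_mul (-μ)).cexp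
  -- Two first integrals, `f' e^{-μt}` and `f' - μf`, replace solving the equation. For `μ ≠ 0`,
  -- comparing them at `T` forces `f' 0 = 0` unless `e^{μT} = 1`; for `μ = 0` the solution is `t ·
  -- f' 0`.
  have h1 : ∀ t, f' t * Complex.exp (-μ * t) = f' 0 := by
    intro t
    have hd : ∀ t, HasDerivAt (fun t : ℝ => f' t * Complex.exp (-μ * t)) 0 t := fun t => by
      refine ((hf' t).mul (hexp t)).congr_deriv ?_
      ring
    have := is_const_of_deriv_eq_zero (fun t => (hd t).differentiableAt)
      (fun t => (hd t).deriv) t 0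
    simpa using this
  have h2 : ∀ t, f' t - μ * f t = f' 0 := by
    intro t
    have hd : ∀ t, HasDerivAt (fun t : ℝ => f' t - μ * f t) 0 t := fun t => by
      refine ((hf' t).sub ((hf t).const_mul μ)).congr_deriv ?_
      ring
    have := is_const_of_deriv_eq_zero (fun t => (hd t).differentiableAt)
      (fun t => (hd t).deriv) t 0
    simpa [h0] using this
  by_cases hz : μ = 0
  · subst hz
    have h3 : ∀ t, f t - t * f' 0 = 0 := by
      intro t
      have hd : ∀ t, HasDerivAt (fun t : ℝ => f t - t * f' 0) 0 t := fun t => by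
        refine ((hf t).sub ((hasDerivAt_id t).ofReal_comp.mul_const (f' 0))).congr_deriv ?_
        have := h2 t
        simp only [zero_mul, sub_zero] at this
        rw [this]; simp
      have := is_const_of_deriv_eq_zero (fun t => (hd t).differentiableAt)
        (fun t => (hd t).deriv) t 0
      simpa [h0] using this
    have h4 := h3 T
    rw [hT, zero_sub, neg_eq_zero, mul_eq_zero] at h4
    have h5 : f' 0 = 0 := h4.resolve_left (by exact_mod_cast hT0)
    simpa [h5] using h3 t
  · have h3 := h2 T
    rw [hT, mul_zero, sub_zero] at h3
    have h4 := h1 T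
    rw [h3] at h4
    have h5 : f' 0 = 0 := by
      by_contra hc
      have h6 := mul_left_cancel₀ hc (h4.trans (mul_one _).symm)
      refine hμ.resolve_left hz ?_
      rw [neg_mul, Complex.exp_neg, inv_eq_one] at h6
      exact h6
    have h6 : f' t = 0 := by
      have := h1 t
      rw [h5, mul_eq_zero] at this
      exact this.resolve_right (Complex.exp_ne_zero _)
    have h7 := h2 t
    rw [h6, h5, zero_sub, neg_eq_zero, mul_eq_zero] at h7
    exact h7.resolve_left hz

/-- The inclusion of `ℝ^q` into `ℂ^q`. -/
def complexify (q : ℕ) : EuclideanSpace ℝ (Fin q) →L[ℝ] EuclideanSpace ℂ (Fin q) :=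
  LinearMap.toContinuousLinearMap
    { toFun := fun v => WithLp.toLp 2 fun j => (v j : ℂ)
      map_add' := fun v w => by ext j; simp
      map_smul' := fun r v => by ext j; simp }

@[simp] theorem complexify_apply {q : ℕ} (v : EuclideanSpace ℝ (Fin q)) (j : Fin q) :
    complexify q v j = v j := rfl

/-- The orthonormal basis of eigenvectors of a skew symmetric matrix. -/
abbrev frequencyBasis {q : ℕ} (Z : so q) :
    OrthonormalBasis (Fin q) ℂ (EuclideanSpace ℂ (Fin q)) :=
  (isHermitian_I_smul Z).eigenvectorBasis

theorem sum_mul_frequencyBasis {q : ℕ} (Z : so q) (k i : Fin q) :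
    ∑ j, ((Z : Matrix (Fin q) (Fin q) ℝ) i j : ℂ) * frequencyBasis Z k j =
      -Complex.I * frequency Z k * frequencyBasis Z k i := by
  have h := congrFun ((isHermitian_I_smul Z).mulVec_eigenvectorBasis k) i
  simp only [Pi.smul_apply, Matrix.mulVec, dotProduct, Complex.real_smul] at h
  change ∑ j, (Complex.I * ((Z : Matrix (Fin q) (Fin q) ℝ) i j : ℂ)) * frequencyBasis Z k j =
    frequency Z k * frequencyBasis Z k i at h
  simp only [mul_assoc Complex.I, ← Finset.mul_sum] at h
  rw [mul_assoc, ← h, ← mul_assoc]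
  simp

/-- Moving the real skew matrix `Z` to the other side of the Hermitian product costs a sign, which
conjugating the eigenvalue `-iλ` undoes. Hence the coordinates of a Jacobi field satisfy decoupled
scalar equations. -/
theorem inner_frequencyBasis_toEuclideanLin {q : ℕ} (Z : so q) (k : Fin q)
    (v : EuclideanSpace ℝ (Fin q)) :
    inner ℂ (frequencyBasis Z k)
      (complexify q (Matrix.toEuclideanLin (Z : Matrix (Fin q) (Fin q) ℝ) v)) =
    (-Complex.I * frequency Z k) * inner ℂ (frequencyBasis Z k) (complexify q v) := by
  have hZ : ∀ i j, (Z : Matrix (Fin q) (Fin q) ℝ) j i = -(Z : Matrix (Fin q) (Fin q) ℝ) i j :=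
    fun i j => congrFun (congrFun ((mem_so _).1 Z.2) i) j
  have hw : ∀ i, ∑ j, ((Z : Matrix (Fin q) (Fin q) ℝ) j i : ℂ) *
      (starRingEnd ℂ) (frequencyBasis Z k j) =
      -Complex.I * frequency Z k * (starRingEnd ℂ) (frequencyBasis Z k i) := by
    intro i
    have := congrArg (starRingEnd ℂ) (sum_mul_frequencyBasis Z k i)
    simp only [map_sum, map_mul, map_neg, Complex.conj_I, Complex.conj_ofReal, neg_neg] at this
    rw [neg_mul, neg_mul, ← this, ← Finset.sum_neg_distrib]
    refine Finset.sum_congr rfl fun j _ => ?_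
    rw [hZ i j]
    push_cast
    ring
  simp only [PiLp.inner_apply, RCLike.inner_apply, complexify_apply, Matrix.toLpLin_apply,
    Matrix.mulVec, dotProduct]
  push_cast
  simp only [Finset.sum_mul]
  rw [Finset.sum_comm, Finset.mul_sum]
  refine Finset.sum_congr rfl fun i _ => ?_
  have := congrArg (fun z : ℂ => z * (v i : ℂ)) (hw i)
  simp only [Finset.sum_mul] at this
  refine Eq.trans ?_ (this.trans (by ring))
  refine Finset.sum_congr rfl fun j _ => by ring

theorem eq_zero_of_inner_frequencyBasis {q : ℕ} (Z : so q) {v : EuclideanSpace ℝ (Fin q)}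
    (h : ∀ k, inner ℂ (frequencyBasis Z k) (complexify q v) = 0) : v = 0 := by
  have h1 : complexify q v = 0 := by
    rw [← (frequencyBasis Z).sum_repr' (complexify q v)]
    simp [h]
  ext j
  have := congrArg (fun x : EuclideanSpace ℂ (Fin q) => x j) h1
  simpa using this

/-- Real and imaginary parts of an eigenvector. -/
theorem exists_rotation_plane {q : ℕ} (Z : so q) (k : Fin q) :
    ∃ a b : EuclideanSpace ℝ (Fin q), (a ≠ 0 ∨ b ≠ 0) ∧
      Matrix.toEuclideanLin (Z : Matrix (Fin q) (Fin q) ℝ) a = frequency Z k • b ∧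
      Matrix.toEuclideanLin (Z : Matrix (Fin q) (Fin q) ℝ) b = -(frequency Z k • a) := by
  refine ⟨WithLp.toLp 2 fun j => (frequencyBasis Z k j).re,
    WithLp.toLp 2 fun j => (frequencyBasis Z k j).im, ?_, ?_, ?_⟩
  · by_contra! hc
    refine (frequencyBasis Z).orthonormal.ne_zero k ?_
    ext j
    have h1 := congrArg (fun x : EuclideanSpace ℝ (Fin q) => x j) hc.1
    have h2 := congrArg (fun x : EuclideanSpace ℝ (Fin q) => x j) hc.2
    exact Complex.ext (by simpa using h1) (by simpa using h2)
  · ext i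
    have := congrArg Complex.re (sum_mul_frequencyBasis Z k i)
    simp only [Complex.re_sum, Complex.re_ofReal_mul] at this
    simp only [Matrix.toLpLin_apply, Matrix.mulVec, dotProduct, PiLp.smul_apply, smul_eq_mul]
    rw [this]
    simp
  · ext i
    have := congrArg Complex.im (sum_mul_frequencyBasis Z k i)
    simp only [Complex.im_sum, Complex.im_ofReal_mul] at this
    simp only [Matrix.toLpLin_apply, Matrix.mulVec, dotProduct, PiLp.neg_apply, PiLp.smul_apply,
      smul_eq_mul]
    rw [this]
    simp

theorem abs_frequency_mem {q : ℕ} (Z : so q) {k : Fin q} (h : frequency Z k ≠ 0) :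
    |frequency Z k| ∈ positiveFrequencies Z := by
  rw [positiveFrequencies, Finset.mem_filter]
  refine ⟨?_, abs_pos.2 h⟩
  simp only [Finset.mem_image, Finset.mem_univ, true_and]
  rcases abs_choice (frequency Z k) with h' | h'
  · exact ⟨k, h'.symm⟩
  · obtain ⟨l, hl⟩ := neg_frequency Z k
    exact ⟨l, hl.trans h'.symm⟩

/-! ### Conjugate values and the primitive ones -/

namespace NilGroup

theorem isConjugateValue_of_frequency {q : ℕ} (W : Submodule ℝ (so q)) (Z : W) {t l : ℝ} {n : ℕ}
    (hl : l ∈ positiveFrequencies (Z : so q)) (hn : 0 < n) (h : l * t = 2 * Real.pi * n) :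
    RiemChart.IsConjugateValue (metric W) (centralGeodesic W Z) t := by
  obtain ⟨hk, hl0⟩ := Finset.mem_filter.1 hl
  obtain ⟨k, _, rfl⟩ := Finset.mem_image.1 hk
  obtain ⟨a, b, hab, hZa, hZb⟩ := exists_rotation_plane (Z : so q) k
  set l := frequency (Z : so q) k
  have hn' : (0 : ℝ) < n := by exact_mod_cast hn
  refine ⟨pos_of_mul_pos_right (h ▸ by positivity) hl0.le, ?_⟩
  -- A primitive of the uniformly rotating vector `l(-sin(sl) a + cos(sl) b)`, normalised to vanish
  -- at `0`; it closes up after each full turn.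
  let ξ : ℝ → EuclideanSpace ℝ (Fin q) := fun s =>
    (Real.cos (s * l) - 1) • a + Real.sin (s * l) • b
  let ξ' : ℝ → EuclideanSpace ℝ (Fin q) := fun s =>
    (-Real.sin (s * l) * (1 * l)) • a + (Real.cos (s * l) * (1 * l)) • b
  have hcos : ∀ s : ℝ, HasDerivAt (fun s => Real.cos (s * l)) (-Real.sin (s * l) * (1 * l)) s :=
    fun s => ((hasDerivAt_id s).mul_const l).cos
  have hsin : ∀ s : ℝ, HasDerivAt (fun s => Real.sin (s * l)) (Real.cos (s * l) * (1 * l)) s :=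
    fun s => ((hasDerivAt_id s).mul_const l).sin
  have hd : ∀ s, HasDerivAt ξ (ξ' s) s := fun s =>
    (((hcos s).sub_const 1).smul_const a).add ((hsin s).smul_const b)
  have hd' : ∀ s, HasDerivAt ξ'
      (Matrix.toEuclideanLin ((Z : so q) : Matrix (Fin q) (Fin q) ℝ) (ξ' s)) s := fun s => by
    refine ((((hsin s).neg.mul_const (1 * l)).smul_const a).add
      (((hcos s).mul_const (1 * l)).smul_const b)).congr_deriv ?_
    simp only [ξ', map_add, map_smul, hZa, hZb]
    module
  refine ⟨fun s => inclV W (ξ s), (isJacobiField_iff W Z _).2 ⟨?_, ?_⟩, ?_, ?_, ?_⟩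
  · simp only [ξ]
    fun_prop
  · have e1 : deriv (fun s => inclV W (ξ s)) = fun s => inclV W (ξ' s) := by
      funext s
      exact ((inclV W).hasFDerivAt.comp_hasDerivAt s (hd s)).deriv
    intro s
    rw [e1, rotation_apply, coordV_inclV]
    exact ((inclV W).hasFDerivAt.comp_hasDerivAt s (hd' s)).deriv
  · intro h0
    have hξ : ∀ s, ξ s = 0 := fun s => by
      have := congrArg (coordV W) (congrFun h0 s)
      simpa [coordV] using this
    -- At half a turn `ξ` is `-2a`; at a quarter turn it is `b - a`. So `ξ` vanishes identically
    -- only if `a = b = 0`.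
    have ha : a = 0 := by
      have := hξ (Real.pi / l)
      simp only [ξ, div_mul_cancel₀ _ hl0.ne', Real.cos_pi, Real.sin_pi, zero_smul, add_zero,
        smul_eq_zero] at this
      exact this.resolve_left (by norm_num)
    have hb : b = 0 := by
      have := hξ (Real.pi / 2 / l)
      simpa only [ξ, div_mul_cancel₀ _ hl0.ne', Real.cos_pi_div_two, Real.sin_pi_div_two, ha,
        smul_zero, zero_add, one_smul] using this
    exact hab.elim (· ha) (· hb)
  · simp [ξ]
  · have h1 : t * l = n * (2 * Real.pi) := by linarith
    simp only [ξ, h1, Real.cos_nat_mul_two_pi]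
    have h2 : Real.sin (n * (2 * Real.pi)) = 0 := by
      rw [show (n : ℝ) * (2 * Real.pi) = ((2 * n : ℕ) : ℝ) * Real.pi by push_cast; ring]
      exact Real.sin_nat_mul_pi _
    simp [h2]

theorem exists_frequency_of_isConjugateValue {q : ℕ} (W : Submodule ℝ (so q)) (Z : W) {t : ℝ}
    (h : RiemChart.IsConjugateValue (metric W) (centralGeodesic W Z) t) :
    ∃ l ∈ positiveFrequencies (Z : so q), ∃ n : ℕ, 0 < n ∧ l * t = 2 * Real.pi * n := by
  obtain ⟨ht, Y, hY, hY0, hY1, hYt⟩ := h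
  obtain ⟨hs, hJ⟩ := (isJacobiField_iff W Z Y).1 hY
  have hd : ∀ s, HasDerivAt Y (deriv Y s) s := fun s =>
    (hs.differentiable (by simp) s).hasDerivAt
  have hd' : ∀ s, HasDerivAt (deriv Y) (rotation W Z (deriv Y s)) s := fun s => by
    rw [← hJ s]
    exact (((contDiff_infty_iff_deriv.1 hs).2).differentiable (by simp) s).hasDerivAt
  have key : ∀ (φ : NilGroup W →L[ℝ] ℂ) (μ : ℂ), (∀ u, φ (rotation W Z u) = μ * φ u) →
      (μ = 0 ∨ Complex.exp (μ * t) ≠ 1) → ∀ s, φ (Y s) = 0 := by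
    intro φ μ hφ hμ
    refine eq_zero_of_boundary (f := fun s => φ (Y s)) (f' := fun s => φ (deriv Y s))
      (fun s => φ.hasFDerivAt.comp_hasDerivAt s (hd s)) (fun s => ?_) (by simp [hY1])
      (by simp [hYt]) ht.ne' hμ
    rw [← hφ]
    exact φ.hasFDerivAt.comp_hasDerivAt s (hd' s)
  -- If no frequency fits `t`, then every nonzero `μ = -iλ` has `e^{μt} ≠ 1`, and each component of
  -- `Y` vanishes by `key`.
  by_contra! hno
  refine hY0 (funext fun s => ?_)
  have hV : coordV W (Y s) = 0 := by
    refine eq_zero_of_inner_frequencyBasis (Z : so q) fun k => ?_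
    let φ : NilGroup W →L[ℝ] ℂ :=
      ((innerSL ℂ (frequencyBasis (Z : so q) k)).restrictScalars ℝ) ∘L complexify q ∘L
        NilAlgebra.projV W ∘L (log W : NilGroup W →L[ℝ] NilAlgebra W)
    refine key φ (-Complex.I * frequency (Z : so q) k)
      (fun u => inner_frequencyBasis_toEuclideanLin (Z : so q) k (coordV W u)) ?_ s
    by_cases hk : frequency (Z : so q) k = 0
    · left; simp [hk]
    · right
      intro he
      obtain ⟨n, hn⟩ := Complex.exp_eq_one_iff.1 he
      have h1 : frequency (Z : so q) k * t = -(2 * Real.pi * n) := by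
        have h2 : ((frequency (Z : so q) k * t : ℝ) : ℂ) = ((-(2 * Real.pi * n) : ℝ) : ℂ) := by
          refine mul_left_cancel₀ (neg_ne_zero.2 Complex.I_ne_zero) ?_
          push_cast
          linear_combination hn
        exact_mod_cast h2
      have h3 : |frequency (Z : so q) k| * t = 2 * Real.pi * (n.natAbs : ℕ) := by
        have := congrArg abs h1
        rw [abs_mul, abs_neg, abs_mul, abs_of_pos ht, abs_of_pos Real.two_pi_pos] at this
        rw [this, Nat.cast_natAbs, Int.cast_abs]
      refine hno _ (abs_frequency_mem (Z : so q) hk) n.natAbs ?_ h3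
      refine Int.natAbs_pos.2 ?_
      rintro rfl
      simp [hk, ht.ne'] at h1
  have hW : coordW W (Y s) = 0 := by
    refine inner_self_eq_zero (𝕜 := ℝ) (E := W).1 ?_
    -- Pairing with the fixed vector `coordW W (Y s)` makes the central part a scalar problem with
    -- `μ = 0`, since `rotation` has no central component.
    let φ : NilGroup W →L[ℝ] ℂ := Complex.ofRealCLM ∘L innerSL ℝ (E := W) (coordW W (Y s)) ∘L
      NilAlgebra.projW W ∘L (log W : NilGroup W →L[ℝ] NilAlgebra W)
    have hφ := key φ 0 (fun u => by
      have : coordW W (rotation W Z u) = 0 := rfl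
      change ((inner ℝ (coordW W (Y s)) (coordW W (rotation W Z u)) : ℝ) : ℂ) = _
      rw [this, inner_zero_right (E := W)]
      simp) (Or.inl rfl) s
    exact Complex.ofReal_eq_zero.1 hφ
  exact (log W).injective (NilAlgebra.ext_proj (by simpa using hV) (by simpa using hW))

theorem ne_mul_of_mem_soGeneric {q : ℕ} {Z : so q} (hZ : Z ∈ soGeneric q) {l l' : ℝ}
    (hl : l ∈ positiveFrequencies Z) (hl' : l' ∈ positiveFrequencies Z) {m : ℕ} (hm : 2 ≤ m) :
    l ≠ m * l' := by
  rintro rfl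
  obtain ⟨hk, h0⟩ := Finset.mem_filter.1 hl
  obtain ⟨hk', h0'⟩ := Finset.mem_filter.1 hl'
  obtain ⟨k, _, hk⟩ := Finset.mem_image.1 hk
  obtain ⟨k', _, rfl⟩ := Finset.mem_image.1 hk'
  have hO : Z ∈ soRatio q m := by
    simp only [soGeneric, Set.mem_iInter] at hZ
    exact hZ m hm
  have hne : (frequency Z k' : ℂ) ≠ 0 := by exact_mod_cast h0'.ne'
  have hm' : (2 : ℝ) ≤ m := by exact_mod_cast hm
  refine (hO.2 _ ((mem_complexEigenvalues Z _).2 ⟨k, rfl⟩) _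
    ((mem_complexEigenvalues Z _).2 ⟨k', rfl⟩) ?_ ?_ ?_).1 ?_
  · intro h
    have h2 := mul_left_cancel₀ (neg_ne_zero.2 Complex.I_ne_zero) h
    have h3 : frequency Z k = frequency Z k' := by exact_mod_cast h2
    nlinarith
  · refine mul_ne_zero (neg_ne_zero.2 Complex.I_ne_zero) ?_
    rw [hk]
    exact_mod_cast h0.ne'
  · exact mul_ne_zero (neg_ne_zero.2 Complex.I_ne_zero) hne
  · rw [hk]
    push_cast
    rw [mul_div_mul_left _ _ (neg_ne_zero.2 Complex.I_ne_zero), mul_div_cancel_right₀ _ hne]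

theorem setOf_isPrimitiveConjugateValue {q : ℕ} (W : Submodule ℝ (so q)) (Z : W)
    (hZ : (Z : so q) ∈ soGeneric q) :
    {t : ℝ | RiemChart.IsPrimitiveConjugateValue (metric W) (centralGeodesic W Z) t} =
      (fun l => 2 * Real.pi / l) '' (positiveFrequencies (Z : so q) : Set ℝ) := by
  ext t
  constructor
  · rintro ⟨ht, hprim⟩
    obtain ⟨l, hl, n, hn, h⟩ := exists_frequency_of_isConjugateValue W Z ht
    have hl0 : 0 < l := (Finset.mem_filter.1 hl).2
    refine ⟨l, hl, ?_⟩
    -- If `n ≥ 2`, then `t` is `n` times the conjugate value `2π/l`, against primitivity.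
    have hn1 : n = 1 := by
      by_contra hne
      refine hprim n (2 * Real.pi / l) (by omega)
        (isConjugateValue_of_frequency W Z hl one_pos ?_) ?_
      · field_simp; simp
      · field_simp; linarith
    subst hn1
    simp only [Nat.cast_one, mul_one] at h
    field_simp
    linarith
  · rintro ⟨l, hl, rfl⟩
    have hl0 : 0 < l := (Finset.mem_filter.1 hl).2
    refine ⟨isConjugateValue_of_frequency W Z hl one_pos (by field_simp; simp), ?_⟩
    intro m t₀ hm ht₀ h
    obtain ⟨l', hl', n, hn, h'⟩ := exists_frequency_of_isConjugateValue W Z ht₀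
    have hmn : 2 ≤ m * n := le_mul_of_le_of_one_le hm hn
    -- From `2π/l = m t₀` and `l' t₀ = 2πn` follows `l' = mn · l`. As `n` is arbitrary, all
    -- multiples `≥ 2` must be excluded, hence the intersection over all `m`.
    refine ne_mul_of_mem_soGeneric hZ hl' hl hmn ?_
    have hpi := Real.pi_pos
    have ht0 : 0 < t₀ := ht₀.1
    simp only [] at h
    rw [div_eq_iff hl0.ne'] at h
    refine mul_right_cancel₀ ht0.ne' ?_
    rw [h', h]
    push_cast
    ring

theorem encard_isPrimitiveConjugateValue {q : ℕ} (W : Submodule ℝ (so q)) (Z : W)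
    (hZ : (Z : so q) ∈ soGeneric q) :
    {t : ℝ | RiemChart.IsPrimitiveConjugateValue (metric W) (centralGeodesic W Z) t}.encard =
      (q / 2 : ℕ) := by
  have hn : (complexEigenvalues ((Z : so q) : Matrix (Fin q) (Fin q) ℝ)).Nodup := by
    simp only [soGeneric, Set.mem_iInter] at hZ
    exact (hZ 2 le_rfl).1
  rw [setOf_isPrimitiveConjugateValue W Z hZ, Set.InjOn.encard_image,
    Set.encard_coe_eq_coe_finsetCard, (card_positiveFrequencies _ hn).1]
  intro l hl l' hl' h
  have h0 : 0 < l := (Finset.mem_filter.1 hl).2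
  have h0' : 0 < l' := (Finset.mem_filter.1 hl').2
  have hpi := Real.pi_pos.ne'
  simp only at h
  field_simp at h
  linarith

end NilGroup

end

theorem proposition8p2 (p q : ℕ) (hq : 2 ≤ q) (hp : 1 ≤ p) (hpq : p ≤ q * (q - 1) / 2) :
    (IsOpen (soGeneric q) ∧
      (∀ g : Matrix.orthogonalGroup (Fin q) ℝ, soConj g '' soGeneric q = soGeneric q) ∧
      IsLebesgueNull (soGeneric q)ᶜ) ∧
    (Dense (grassmannGeneric p q) ∧ IsOpen (grassmannGeneric p q) ∧
      (∀ g : Matrix.orthogonalGroup (Fin q) ℝ,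
        Grassmann.map (soConj g) '' grassmannGeneric p q = grassmannGeneric p q)) ∧
    (∀ W ∈ grassmannGeneric p q,
      IsOpen {Z : W.1 | (Z : so q) ∈ soGeneric q} ∧
      IsLebesgueNull {Z : W.1 | (Z : so q) ∉ soGeneric q}) ∧
    (∀ W ∈ grassmannGeneric p q, ∀ Z : W.1, (Z : so q) ∈ soGeneric q →
      RiemChart.IsGeodesic (NilGroup.metric W.1) (NilGroup.centralGeodesic W.1 Z) ∧
      {t : ℝ | RiemChart.IsPrimitiveConjugateValue (NilGroup.metric W.1)
        (NilGroup.centralGeodesic W.1 Z) t}.encard = (q / 2 : ℕ)) := by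
  have : NeZero q := ⟨by omega⟩
  refine ⟨⟨isOpen_soGeneric q, image_soConj_soGeneric,
    isLebesgueNull_notMem_soGeneric LinearMap.id (soGeneric_nonempty q)⟩,
    ⟨dense_grassmannGeneric hp, isOpen_grassmannGeneric p q, image_map_soConj_grassmannGeneric⟩,
    ?_, ?_⟩
  · rintro W ⟨Z, hZ, hO⟩
    exact ⟨(isOpen_soGeneric q).preimage continuous_subtype_val,
      isLebesgueNull_notMem_soGeneric W.1.subtype ⟨⟨Z, hZ⟩, hO⟩⟩
  · intro W _ Z hZ
    exact ⟨NilGroup.isGeodesic_centralGeodesic W.1 Z,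
      NilGroup.encard_isPrimitiveConjugateValue W.1 Z hZ⟩
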